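/- **Setting.** Fix a full sub-2-category $\mathcal{D}ia\subset\mathrm{Cat}$ of small categories containing the finite posets and closed under binary coproducts and under the comma categories $f\downarrow y$ (for $f\colon X\to Y$ in $\mathcal{D}ia$, $y\in Y$). Let $e$ be the final category. A *prederivator* is a strict 2-functor $\mathbb{D}\colon\mathcal{D}ia^{op}\to\mathrm{Cat}$ to small categories (reversing 1-cells only); $f^*=\mathbb{D}(f)$. Prederivators, pseudonatural transformations and modifications form a 2-category; *equivalences* are meant in it. A morphism is *strict* if its structure 2-cells are identities. A *right derivator* is a prederivator such that: (1) $\mathbb{D}(X\sqcup Y)\to\mathbb{D}(X)\times\mathbb{D}(Y)$ is an equivalence, and $\mathbb{D}(\emptyset)$ is equivalent to $e$; (2) a morphism of $\mathbb{D}(X)$ is an isomorphism if its restrictions along all $x\colon e\to X$ are; (3) each $f^*$ has a left adjoint $f_!$; (4) for $f\colon X\to Y$ and $y\in Y$, with $j\colon f\downarrow y\to X$ and $p\colon f\downarrow y\to e$ the projections, the canonical map $p_!j^*\to y^*f_!$ is an isomorphism. It is *pointed* if every $\mathbb{D}(X)$ has a zero object and all $f^*$ preserve zero objects. A morphism $\varphi$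 of right derivators is *cocontinuous* if the canonical maps $f_!\varphi(X)\to\varphi(Y)f_!$ are isomorphisms. Let $\operatorname{iso}_n\mathbb{D}$ be the prederivator with $(\operatorname{iso}_n\mathbb{D})(X)$ the full subcategory of $\mathrm{Fun}([n],\mathbb{D}(X))$ on the strings of $n$ composable isomorphisms. Let $S$ be a class (for instance a small set) of pointed right derivators such that every pointed right derivator of the form $\operatorname{iso}_n\mathbb{D}$, $\mathbb{D}\in S$, $n\ge 0$, is in $S$. Let $\mathrm{Der}_S$ be the category with objects $S$ and morphisms the strict cocontinuous morphisms. **$K$-theory.** Let $\mathrm{Ar}[n]$ be the poset of pairs $i\le j$ in $[n]$, written $i\to j$. Let $\mathcal{S}_n\mathbb{D}\subset\mathbb{D}(\mathrm{Ar}[n])$ be the full subcategory of those $F$ whose value at each $i\to i$ is a zero object and whose restriction to each square $(i\to j),(i\to k),(j\to j),(j\to k)$, $i\le j\le k$, is cocartesian, i.e. the counit $(i_\ulcorner)_!(i_\ulcorner)^*G\to G$ is an isomorphism for this restriction $G\in\mathbb{D}([1]\times[1])$, where $i_\ulcorner$ is the inclusion of $[1]\times[1]\setminus\{(1,1)\}$.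 This gives a simplicial category $\mathcal{S}_\bullet\mathbb{D}$, functorial on $\mathrm{Der}_S$. Define functors $\mathrm{Der}_S\to\mathcal{SS}et$ to simplicial sets by $$\Omega^{-1}K^{W,\mathrm{ob}}(\mathbb{D})=\mathrm{Ob}\,\mathcal{S}_\bullet\mathbb{D},\qquad \Omega^{-1}K(\mathbb{D})=\operatorname{diag}N_\bullet\operatorname{iso}\mathcal{S}_\bullet\mathbb{D},$$ where $\operatorname{iso}$ is the maximal subgroupoid and $N_\bullet$ the nerve, and let $\mu^{\mathrm{ob}}\colon\Omega^{-1}K^{W,\mathrm{ob}}\Rightarrow\Omega^{-1}K$ send an object to the constant string of its identities. **Invariant approximations.** $\mathtt{App}$ is the full subcategory of the comma category $\Omega^{-1}K^{W,\mathrm{ob}}\downarrow\mathcal{SS}et^{\mathrm{Der}_S}$ on those $\eta\colon\Omega^{-1}K^{W,\mathrm{ob}}\Rightarrow F$ such that $F$ sends the morphisms of $\mathrm{Der}_S$ that are equivalences of prederivators to weak equivalences of simplicial sets. A morphism $(\eta,F)\to(\eta',F')$ of $\mathtt{App}$ is a *weak equivalence* if all components of $F\Rightarrow F'$ are weak equivalences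 of simplicial sets. Let $\mathcal{C}$ be a category with a class $\mathcal{W}$ of weak equivalences containing the identities and satisfying 2-out-of-6. A functor $\mathcal{C}\to\mathcal{C}$ is *homotopical* if it preserves weak equivalences; two functors are *naturally weakly equivalent* if they are connected by a zigzag of natural transformations with components in $\mathcal{W}$. An object $X$ is *homotopically initial* if there are homotopical functors $F_0,F_1\colon\mathcal{C}\to\mathcal{C}$ and a natural transformation $f\colon F_0\Rightarrow F_1$ such that $F_0$ is naturally weakly equivalent to the constant functor at $X$, $F_1$ is naturally weakly equivalent to $\mathrm{id}_{\mathcal{C}}$, and $f_X$ is a weak equivalence. **Theorem.** The weak equivalences of $\mathtt{App}$ contain the identities and satisfy 2-out-of-6, $\mu^{\mathrm{ob}}\colon\Omega^{-1}K^{W,\mathrm{ob}}\Rightarrow\Omega^{-1}K$ is an object of $\mathtt{App}$, and it is homotopically initial in $\mathtt{App}$. -/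

import Mathlib

universe u v w

open CategoryTheory Bicategory Opposite Limits Simplicial
open scoped CategoryTheory.Pseudofunctor.StrongTrans

namespace DerivatorK

/-- A full sub-2-category `Dia` of `Cat` (small categories serving as shapes of diagrams). It contains
the finite posets and is closed under binary coproducts and under the comma categories `f ↓ y`. -/
structure DiagramShapes where
  mem : Cat.{u, u} → Prop
  mem_poset : ∀ (P : Type u) [PartialOrder P] [Finite P], mem (Cat.of P)
  mem_sum : ∀ (X Y : Type u) [SmallCategory X] [SmallCategory Y],
    mem (Cat.of X) → mem (Cat.of Y) → mem (Cat.of (X ⊕ Y))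
  mem_comma : ∀ {X Y : Type u} [SmallCategory X] [SmallCategory Y] (f : X ⥤ Y) (y : Y),
    mem (Cat.of X) → mem (Cat.of Y) → mem (Cat.of (CostructuredArrow f y))

namespace DiagramShapes

variable (𝒟 : DiagramShapes.{u})

/-- The 2-category `Dia`: all functors and all natural transformations between shapes. -/
abbrev Shape : Type (u + 1) :=
  InducedBicategory Cat.{u, u} (fun X : {X : Cat.{u, u} // 𝒟.mem X} => X.1)

variable {𝒟}

abbrev Shape.cat (X : 𝒟.Shape) : Cat.{u, u} := Subtype.val (p := 𝒟.mem) X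

variable (𝒟)

/-- A finite poset as a shape. -/
def poset (P : Type u) [PartialOrder P] [Finite P] : 𝒟.Shape := ⟨Cat.of P, 𝒟.mem_poset P⟩

/-- The empty category. -/
def empty : 𝒟.Shape := 𝒟.poset PEmpty.{u + 1}
/-- The final category `e`. -/
def point : 𝒟.Shape := 𝒟.poset PUnit.{u + 1}

variable {𝒟}

/-- The coproduct `X ⊔ Y`. -/
def Shape.sum (X Y : 𝒟.Shape) : 𝒟.Shape :=
  ⟨Cat.of (X.cat ⊕ Y.cat), 𝒟.mem_sum _ _ X.2 Y.2⟩

/-- The comma category `f ↓ y` of pairs `(x, f x ⟶ y)`. -/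
def Shape.comma {X Y : 𝒟.Shape} (f : X.cat ⥤ Y.cat) (y : Y.cat) : 𝒟.Shape :=
  ⟨Cat.of (CostructuredArrow f y), 𝒟.mem_comma f y X.2 Y.2⟩

/-- The functor `i_{X,x} : e ⥤ X` with value `x`. -/
def Shape.pt {X : 𝒟.Shape} (x : X.cat) : 𝒟.point.cat ⥤ X.cat := (Functor.const _).obj x

/-- The functor `X ⥤ e`. -/
def Shape.toPt (X : 𝒟.Shape) : X.cat ⥤ 𝒟.point.cat := (Functor.const _).obj PUnit.unit

/-- The source functor `j : f ↓ y ⥤ X`. -/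
def commaSource {X Y : 𝒟.Shape} (f : X.cat ⥤ Y.cat) (y : Y.cat) :
    (Shape.comma f y).cat ⥤ X.cat := CostructuredArrow.proj f y

/-- The natural transformation `j ⋙ f ⟶ p ⋙ i_y` with component `f x ⟶ y` at `(x, f x ⟶ y)`. -/
def commaCell {X Y : 𝒟.Shape} (f : X.cat ⥤ Y.cat) (y : Y.cat) :
    commaSource f y ⋙ f ⟶ (Shape.comma f y).toPt ⋙ Shape.pt y where
  app a := CostructuredArrow.hom a
  naturality a b g := by
    exact (CostructuredArrow.w g).trans (Category.comp_id _).symm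

end DiagramShapes

/-- A prederivator with domain `Dia`: a strict 2-functor `Diaᵒᵖ ⥤ Cat`. Here `ᵒᵖ` reverses 1-cells
and keeps the direction of 2-cells. -/
abbrev Prederivator (𝒟 : DiagramShapes.{u}) :=
  StrictPseudofunctor 𝒟.Shapeᵒᵖ Cat.{u, u}

namespace Prederivator
variable {𝒟 : DiagramShapes.{u}} (D : Prederivator 𝒟)

/-- The category `D(X)`. -/
abbrev on (X : 𝒟.Shape) : Cat.{u, u} := D.obj (op X)

/-- A functor between shapes, as a 1-cell of `Dia`. -/
abbrev cell {X Y : 𝒟.Shape} (f : X.cat ⥤ Y.cat) : X ⟶ Y :=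
  InducedBicategory.mkHom (Functor.toCatHom f)

/-- The inverse image functor `f^* : D(Y) ⥤ D(X)`. -/
abbrev pull {X Y : 𝒟.Shape} (f : X.cat ⥤ Y.cat) : D.on Y ⥤ D.on X :=
  (D.map (cell f).op).toFunctor

/-- The natural transformation `α^* : f^* ⟶ g^*`. -/
abbrev pull₂ {X Y : 𝒟.Shape} {f g : X.cat ⥤ Y.cat} (α : f ⟶ g) : D.pull f ⟶ D.pull g :=
  (D.map₂ (Bicategory.Opposite.op2 (InducedBicategory.mkHom₂ (NatTrans.toCatHom₂ α)))).toNatTrans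

theorem pull_id (X : 𝒟.Shape) : D.pull (𝟭 X.cat) = 𝟭 (D.on X) :=
  congrArg Cat.Hom.toFunctor (D.map_id (op X))

theorem pull_comp {X Y Z : 𝒟.Shape} (f : X.cat ⥤ Y.cat) (g : Y.cat ⥤ Z.cat) :
    D.pull (f ⋙ g) = D.pull g ⋙ D.pull f :=
  congrArg Cat.Hom.toFunctor (D.map_comp (cell g).op (cell f).op)

end Prederivator

/-- The full subcategory of `[n] ⥤ C` on the strings of `n` composable isomorphisms. -/
abbrev IsoStrings (C : Type u) [SmallCategory C] (n : ℕ) : Type u :=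
  ObjectProperty.FullSubcategory
    (fun F : Fin (n + 1) ⥤ C => ∀ ⦃i j : Fin (n + 1)⦄ (f : i ⟶ j), IsIso (F.map f))

def IsoStrings.map {C C' : Type u} [SmallCategory C] [SmallCategory C'] (G : C ⥤ C') (n : ℕ) :
    IsoStrings C n ⥤ IsoStrings C' n where
  obj F := ⟨F.obj ⋙ G, fun i j f => by
    have := F.property f
    exact inferInstanceAs (IsIso (G.map (F.obj.map f)))⟩
  map α := ObjectProperty.homMk (Functor.whiskerRight α.hom G)

def IsoStrings.map₂ {C C' : Type u} [SmallCategory C] [SmallCategory C'] {G G' : C ⥤ C'}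
    (α : G ⟶ G') (n : ℕ) : IsoStrings.map G n ⟶ IsoStrings.map G' n where
  app F := ObjectProperty.homMk (Functor.whiskerLeft F.obj α)
  naturality F F' g := by
    ext i
    exact α.naturality _

/-- The strict 2-functor `C ↦ IsoStrings C n` of `Cat`. -/
def isoStringsFunctor (n : ℕ) : StrictPseudofunctor Cat.{u, u} Cat.{u, u} :=
  StrictPseudofunctor.mk'' {
    obj C := Cat.of (IsoStrings C n)
    map G := (IsoStrings.map G.toFunctor n).toCatHom
    map₂ α := (IsoStrings.map₂ α.toNatTrans n).toCatHom₂
    map₂_whisker_left _ _ _ _ := (conj_eqToHom_iff_heq' _ _ _ _).2 HEq.rfl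
    map₂_whisker_right _ _ := (conj_eqToHom_iff_heq' _ _ _ _).2 HEq.rfl }

namespace Prederivator
variable {𝒟 : DiagramShapes.{u}}

/-- The prederivator `iso_n D`, with `(iso_n D)(X) = IsoStrings (D(X)) n`. -/
def iso (D : Prederivator 𝒟) (n : ℕ) : Prederivator 𝒟 := D.comp (isoStringsFunctor n)

/-- Morphisms of prederivators: pseudonatural transformations. -/
abbrev Mor (D E : Prederivator 𝒟) := D.toPseudofunctor ⟶ E.toPseudofunctor

/-- Equivalences in the 2-category `PDer` of prederivators, pseudonatural transformations and
modifications. -/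
def IsEquivalence {D E : Prederivator 𝒟} (φ : Mor D E) : Prop :=
  ∃ ψ : Mor E D, Nonempty (φ ≫ ψ ≅ 𝟙 D.toPseudofunctor) ∧ Nonempty (ψ ≫ φ ≅ 𝟙 E.toPseudofunctor)

/-- A morphism is strict if it commutes with all `f^*` and its structure 2-cells are identities. -/
def IsStrict {D E : Prederivator 𝒟} (φ : Mor D E) : Prop :=
  ∀ ⦃a b : 𝒟.Shapeᵒᵖ⦄ (f : a ⟶ b), ∃ h : D.map f ≫ φ.app b = φ.app a ≫ E.map f,
    φ.naturality f = eqToIso h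

theorem IsStrict.ext {D E : Prederivator 𝒟} {φ ψ : Mor D E} (hφ : IsStrict φ) (hψ : IsStrict ψ)
    (h : φ.app = ψ.app) : φ = ψ := by
  obtain ⟨a, n, _, _, _⟩ := φ
  obtain ⟨a', n', _, _, _⟩ := ψ
  obtain rfl : a = a' := h
  have : @n = @n' := by
    funext x y f
    obtain ⟨h, h'⟩ := hφ f
    obtain ⟨k, k'⟩ := hψ f
    exact h'.trans k'.symm
  subst this
  rfl

theorem isStrict_id (D : Prederivator 𝒟) : IsStrict (𝟙 D.toPseudofunctor : Mor D D) := by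
  intro a b f
  refine ⟨by simp, ?_⟩
  ext1
  simp [Strict.leftUnitor_eqToIso, Strict.rightUnitor_eqToIso]
  rfl

theorem IsStrict.comp {D E F : Prederivator 𝒟} {φ : Mor D E} {ψ : Mor E F} (hφ : IsStrict φ)
    (hψ : IsStrict ψ) : IsStrict (φ ≫ ψ : Mor D F) := by
  intro a b f
  obtain ⟨h, h'⟩ := hφ f
  obtain ⟨k, k'⟩ := hψ f
  refine ⟨?_, ?_⟩
  · show D.map f ≫ φ.app b ≫ ψ.app b = (φ.app a ≫ ψ.app a) ≫ F.map f
    rw [← Category.assoc, h, Category.assoc, k, Category.assoc]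
  · ext1
    simp [h', k', Strict.associator_eqToIso]
    erw [Category.id_comp, Category.id_comp, Category.comp_id, eqToHom_trans]
    rfl

/-- The component `φ(X) : D(X) ⥤ E(X)`. -/
abbrev Mor.on {D E : Prederivator 𝒟} (φ : Mor D E) (X : 𝒟.Shape) : D.on X ⥤ E.on X :=
  (φ.app (op X)).toFunctor

/-- The structure isomorphism comparing `φ(X) ∘ f^*` with `f^* ∘ φ(Y)`. -/
abbrev Mor.square {D E : Prederivator 𝒟} (φ : Mor D E) {X Y : 𝒟.Shape} (f : X.cat ⥤ Y.cat) :
    D.pull f ⋙ φ.on X ≅ φ.on Y ⋙ E.pull f :=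
  Cat.Hom.toNatIso (φ.naturality (cell f).op)

end Prederivator


/-- The mate `G ⋙ L' ⟶ L ⋙ H` of `β : R ⋙ G ⟶ H ⋙ R'` for adjunctions `L ⊣ R` and `L' ⊣ R'`, i.e. the
composite `L' G ⟶ L' G R L ⟶ L' R' H L ⟶ H L` (in the usual order of composition). -/
def mate {A B A' B' : Type u} [SmallCategory A] [SmallCategory B] [SmallCategory A']
    [SmallCategory B'] {L : A ⥤ B} {R : B ⥤ A} {L' : A' ⥤ B'} {R' : B' ⥤ A'}
    (adj : L ⊣ R) (adj' : L' ⊣ R') {G : A ⥤ A'} {H : B ⥤ B'} (β : R ⋙ G ⟶ H ⋙ R') :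
    G ⋙ L' ⟶ L ⋙ H :=
  ((mateEquiv adj adj').symm (TwoSquare.mk R H G R' β)).natTrans

section mate
variable {A B A' B' A'' B'' : Type u} [SmallCategory A] [SmallCategory B] [SmallCategory A']
    [SmallCategory B'] [SmallCategory A''] [SmallCategory B''] {L : A ⥤ B} {R : B ⥤ A}
    {L' : A' ⥤ B'} {R' : B' ⥤ A'} {L'' : A'' ⥤ B''} {R'' : B'' ⥤ A''}
    (adj : L ⊣ R) (adj' : L' ⊣ R') (adj'' : L'' ⊣ R'') {G : A ⥤ A'} {H : B ⥤ B'}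
    {G' : A' ⥤ A''} {H' : B' ⥤ B''}

theorem mate_app (β : R ⋙ G ⟶ H ⋙ R') (a : A) :
    (mate adj adj' β).app a = L'.map (G.map (adj.unit.app a)) ≫ L'.map (β.app (L.obj a)) ≫
      adj'.counit.app (H.obj (L.obj a)) := by
  simp [mate]

theorem isIso_mate_id (β : R ⋙ 𝟭 A ⟶ 𝟭 B ⋙ R) (hβ : ∀ b, β.app b = 𝟙 (R.obj b)) :
    IsIso (mate adj adj β) := by
  have : mate adj adj β = 𝟙 L := by
    ext a
    rw [mate_app, hβ]
    simp
  rw [this]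
  exact inferInstanceAs (IsIso (𝟙 L))

theorem isIso_mate_comp (β : R ⋙ G ⟶ H ⋙ R') (β' : R' ⋙ G' ⟶ H' ⋙ R'')
    [IsIso (mate adj adj' β)] [IsIso (mate adj' adj'' β')]
    (γ : R ⋙ G ⋙ G' ⟶ (H ⋙ H') ⋙ R'')
    (hγ : ∀ b, γ.app b = G'.map (β.app b) ≫ β'.app (H.obj b)) :
    IsIso (mate adj adj'' γ) := by
  rw [NatTrans.isIso_iff_isIso_app]
  intro a
  have : (mate adj adj'' γ).app a =
      (mate adj' adj'' β').app (G.obj a) ≫ H'.map ((mate adj adj' β).app a) := by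
    have key : adj'.unit.app (G.obj a) ≫ R'.map ((mate adj adj' β).app a) =
        G.map (adj.unit.app a) ≫ β.app (L.obj a) := by
      have h : (mate adj adj' β).app a =
          (adj'.homEquiv _ _).symm (G.map (adj.unit.app a) ≫ β.app (L.obj a)) := by
        rw [mate_app, Adjunction.homEquiv_counit, Functor.map_comp_assoc]
      rw [h]
      exact (adj'.homEquiv_unit ..).symm.trans (Equiv.apply_symm_apply _ _)
    have nat := β'.naturality ((mate adj adj' β).app a)
    have nat' := adj''.counit_naturality (H'.map ((mate adj adj' β).app a))
    simp only [Functor.comp_map, Functor.comp_obj] at nat nat'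
    rw [mate_app adj adj'', mate_app adj' adj'', hγ, Category.assoc, Category.assoc, ← nat',
      ← L''.map_comp_assoc (β'.app _), ← nat, L''.map_comp]
    have key' : L''.map (G'.map (adj'.unit.app (G.obj a))) ≫
        L''.map (G'.map (R'.map ((mate adj adj' β).app a))) =
          L''.map (G'.map (G.map (adj.unit.app a))) ≫ L''.map (G'.map (β.app (L.obj a))) := by
      rw [← L''.map_comp, ← G'.map_comp, key, G'.map_comp, L''.map_comp]
    simp only [Functor.map_comp, Functor.comp_map, Functor.comp_obj, Category.assoc]
    rw [reassoc_of% key']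
  rw [this]
  infer_instance

/-- Compatibility of a mate with counits. -/
theorem isIso_counit_of_mate (β : R ⋙ G ⟶ H ⋙ R') [IsIso β] [IsIso (mate adj adj' β)] (b : B)
    [IsIso (adj.counit.app b)] : IsIso (adj'.counit.app (H.obj b)) := by
  have h : L'.map (β.app b) ≫ adj'.counit.app (H.obj b) =
      (mate adj adj' β).app (R.obj b) ≫ H.map (adj.counit.app b) :=
    mateEquiv_counit_symm adj adj' (TwoSquare.mk R H G R' β) b
  have : IsIso (L'.map (β.app b) ≫ adj'.counit.app (H.obj b)) := by
    rw [h]; infer_instance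
  exact IsIso.of_isIso_comp_left (L'.map (β.app b)) _

end mate

namespace Prederivator
variable {𝒟 : DiagramShapes.{u}}

/-- Every inverse image functor has a left adjoint. -/
def HasLan (D : Prederivator 𝒟) : Prop :=
  ∀ ⦃X Y : 𝒟.Shape⦄ (f : X.cat ⥤ Y.cat), (D.pull f).IsRightAdjoint

variable {D E F : Prederivator 𝒟}

/-- The left adjoint `f_!` of `f^*`. -/
noncomputable def HasLan.lan (h : D.HasLan) {X Y : 𝒟.Shape} (f : X.cat ⥤ Y.cat) :
    D.on X ⥤ D.on Y :=
  haveI := h f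
  (D.pull f).leftAdjoint

/-- The adjunction `f_! ⊣ f^*`. -/
noncomputable def HasLan.adj (h : D.HasLan) {X Y : 𝒟.Shape} (f : X.cat ⥤ Y.cat) :
    h.lan f ⊣ D.pull f :=
  haveI := h f
  Adjunction.ofIsRightAdjoint (D.pull f)

/-- The 2-cell `j^* f^* = (f j)^* ⟶ (i_y p)^* = p^* i_y^*` induced by `commaCell`. -/
def commaSquare (D : Prederivator 𝒟) {X Y : 𝒟.Shape} (f : X.cat ⥤ Y.cat) (y : Y.cat) :
    D.pull f ⋙ D.pull (DiagramShapes.commaSource f y) ⟶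
      D.pull (DiagramShapes.Shape.pt y) ⋙ D.pull (DiagramShapes.Shape.comma f y).toPt :=
  eqToHom (D.pull_comp _ _).symm ≫ D.pull₂ (DiagramShapes.commaCell f y) ≫
    eqToHom (D.pull_comp _ _)

/-- Right derivators: `D` sends coproducts to products, including the empty one (up to equivalence),
isomorphisms are detected pointwise, left Kan extensions exist and are computed pointwise. -/
structure IsRightDerivator (D : Prederivator 𝒟) : Prop where
  sum : ∀ X Y : 𝒟.Shape, (Functor.prod' (D.pull (X := X) (Y := X.sum Y) (Sum.inl_ X.cat Y.cat))
    (D.pull (X := Y) (Y := X.sum Y) (Sum.inr_ X.cat Y.cat))).IsEquivalence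
  empty : Nonempty (D.on 𝒟.empty ≌ Discrete PUnit.{u + 1})
  conservative : ∀ (X : 𝒟.Shape) ⦃F G : D.on X⦄ (φ : F ⟶ G),
    (∀ x : X.cat, IsIso ((D.pull (DiagramShapes.Shape.pt x)).map φ)) → IsIso φ
  hasLan : D.HasLan
  baseChange : ∀ ⦃X Y : 𝒟.Shape⦄ (f : X.cat ⥤ Y.cat) (y : Y.cat),
    IsIso (mate (hasLan.adj f) (hasLan.adj (DiagramShapes.Shape.comma f y).toPt) (D.commaSquare f y))

/-- Pointed prederivators: all `D(X)` have a zero object and all `f^*` preserve zero objects. -/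
structure IsPointed (D : Prederivator 𝒟) : Prop where
  hasZero : ∀ X : 𝒟.Shape, HasZeroObject (D.on X)
  pull_isZero : ∀ ⦃X Y : 𝒟.Shape⦄ (f : X.cat ⥤ Y.cat) ⦃Z : D.on Y⦄,
    IsZero Z → IsZero ((D.pull f).obj Z)

/-- A morphism is cocontinuous if the canonical maps `f_! φ(X) ⟶ φ(Y) f_!` are isomorphisms. -/
def IsCocontinuous (hD : D.HasLan) (hE : E.HasLan) (φ : Mor D E) : Prop :=
  ∀ ⦃X Y : 𝒟.Shape⦄ (f : X.cat ⥤ Y.cat),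
    IsIso (mate (hD.adj f) (hE.adj f) (φ.square f).hom)

theorem isCocontinuous_id (hD : D.HasLan) : IsCocontinuous hD hD (𝟙 D.toPseudofunctor) := by
  intro X Y f
  exact isIso_mate_id (hD.adj f) _ fun b => by
    simp [Mor.square]

theorem IsCocontinuous.comp {hD : D.HasLan} {hE : E.HasLan} {hF : F.HasLan}
    {φ : Mor D E} {ψ : Mor E F} (hφ : IsCocontinuous hD hE φ) (hψ : IsCocontinuous hE hF ψ) :
    IsCocontinuous hD hF (φ ≫ ψ) := by
  intro X Y f
  have := hφ f
  have := hψ f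
  exact isIso_mate_comp (hD.adj f) (hE.adj f) (hF.adj f) (φ.square f).hom (ψ.square f).hom _
    fun b => (Category.id_comp _).trans (congrArg (_ ≫ ·)
      ((Category.id_comp _).trans (Category.comp_id _)))

end Prederivator

open Prederivator

/-- Pointed right derivators with domain `Dia`. -/
structure PointedRightDerivator (𝒟 : DiagramShapes.{u}) where
  toPre : Prederivator 𝒟
  isRight : toPre.IsRightDerivator
  isPointed : toPre.IsPointed

namespace PointedRightDerivator
variable {𝒟 : DiagramShapes.{u}}

/-- Morphisms of pointed right derivators: strict cocontinuous morphisms of prederivators. -/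
@[ext]
structure Hom (D E : PointedRightDerivator 𝒟) where
  mor : Mor D.toPre E.toPre
  isStrict : IsStrict mor
  isCocontinuous : IsCocontinuous D.isRight.hasLan E.isRight.hasLan mor

/-- The 1-category of pointed right derivators and strict cocontinuous morphisms. -/
instance : Category (PointedRightDerivator 𝒟) where
  Hom := Hom
  id D := ⟨𝟙 D.toPre.toPseudofunctor, isStrict_id _, isCocontinuous_id _⟩
  comp φ ψ := ⟨φ.mor ≫ ψ.mor, φ.isStrict.comp ψ.isStrict, φ.isCocontinuous.comp ψ.isCocontinuous⟩
  id_comp φ := Hom.ext ((isStrict_id _).comp φ.isStrict |>.ext φ.isStrict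
    (funext fun _ => Category.id_comp (φ.mor.app _)))
  comp_id φ := Hom.ext (φ.isStrict.comp (isStrict_id _) |>.ext φ.isStrict
    (funext fun _ => Category.comp_id (φ.mor.app _)))
  assoc φ ψ χ := Hom.ext (((φ.isStrict.comp ψ.isStrict).comp χ.isStrict).ext
    (φ.isStrict.comp (ψ.isStrict.comp χ.isStrict))
    (funext fun _ => Category.assoc (φ.mor.app _) (ψ.mor.app _) (χ.mor.app _)))

end PointedRightDerivator

namespace DiagramShapes
variable (𝒟 : DiagramShapes.{u})

/-- The poset `Ar[n]` of arrows `i → j` of `[n]`. -/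
abbrev Ar (n : ℕ) : Type u := ULift.{u} {p : Fin (n + 1) × Fin (n + 1) // p.1 ≤ p.2}

namespace Ar

/-- The arrow `i → j`. -/
abbrev mk {n : ℕ} (i j : Fin (n + 1)) (h : i ≤ j) : Ar.{u} n := ⟨⟨(i, j), h⟩⟩

/-- The functor `Ar[m] ⥤ Ar[n]` induced by `σ : [m] → [n]`. -/
def map {m n : ℕ} (σ : Fin (m + 1) →o Fin (n + 1)) : Ar.{u} m ⥤ Ar.{u} n :=
  Monotone.functor (f := fun p => mk (σ p.down.1.1) (σ p.down.1.2) (σ.monotone p.down.2))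
    fun _ _ h => ⟨σ.monotone h.1, σ.monotone h.2⟩

end Ar

/-- The poset `[1] × [1]`; the first coordinate is the horizontal one. -/
abbrev Square : Type u := ULift.{u} (Fin 2 × Fin 2)

/-- The subposet of `[1] × [1]` obtained by removing `(1, 1)`. -/
abbrev Corner : Type u := ULift.{u} {p : Fin 2 × Fin 2 // p ≠ (1, 1)}

/-- The inclusion of the corner in the square. -/
def cornerIncl : Corner.{u} ⥤ Square.{u} :=
  Monotone.functor (f := fun p => ⟨p.down.1⟩) fun _ _ h => h

/-- The square in `Ar[n]` with upper row `(i → j) ⟶ (i → k)` and lower row `(j → j) ⟶ (j → k)`. -/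
def Ar.square {n : ℕ} (i j k : Fin (n + 1)) (hij : i ≤ j) (hjk : j ≤ k) : Square.{u} ⥤ Ar.{u} n :=
  Monotone.functor
    (f := fun p => mk (if p.down.2 = 0 then i else j) (if p.down.1 = 0 then j else k)
      (by split_ifs; exacts [hij, hij.trans hjk, le_rfl, hjk]))
    (by
      rintro ⟨a, b⟩ ⟨a', b'⟩ ⟨h₁, h₂⟩
      constructor
      · show (if b = 0 then i else j) ≤ (if b' = 0 then i else j)
        have : b ≤ b' := h₂
        split_ifs with h h'
        · exact le_rfl
        · exact hij
        · omega
        · exact le_rfl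
      · show (if a = 0 then j else k) ≤ (if a' = 0 then j else k)
        have : a ≤ a' := h₁
        split_ifs with h h'
        · exact le_rfl
        · exact hjk
        · omega
        · exact le_rfl)

abbrev arShape (n : ℕ) : 𝒟.Shape := 𝒟.poset (Ar.{u} n)
abbrev squareShape : 𝒟.Shape := 𝒟.poset Square.{u}
abbrev cornerShape : 𝒟.Shape := 𝒟.poset Corner.{u}

end DiagramShapes

section restrict
variable {C C' C'' : Type u} [SmallCategory C] [SmallCategory C'] [SmallCategory C'']
  (P : ObjectProperty C) (P' : ObjectProperty C') (P'' : ObjectProperty C'')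

/-- The restriction of a functor to full subcategories. -/
def restrictFunctor (F : C ⥤ C') (h : ∀ X, P X → P' (F.obj X)) :
    P.FullSubcategory ⥤ P'.FullSubcategory :=
  P'.lift (P.ι ⋙ F) fun X => h _ X.property

theorem restrictFunctor_id (F : C ⥤ C) (h : ∀ X, P X → P (F.obj X)) (hF : F = 𝟭 C) :
    restrictFunctor P P F h = 𝟭 _ := by
  subst hF
  rfl

theorem restrictFunctor_comp (F : C ⥤ C') (G : C' ⥤ C'') (H : C ⥤ C'')
    (hF : ∀ X, P X → P' (F.obj X)) (hG : ∀ X, P' X → P'' (G.obj X)) (hH : ∀ X, P X → P'' (H.obj X))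
    (e : H = F ⋙ G) :
    restrictFunctor P P'' H hH = restrictFunctor P P' F hF ⋙ restrictFunctor P' P'' G hG := by
  subst e
  rfl

theorem restrictFunctor_square {C''' : Type u} [SmallCategory C'''] (P''' : ObjectProperty C''')
    (F : C ⥤ C') (G : C' ⥤ C''') (F' : C ⥤ C'') (G' : C'' ⥤ C''')
    (hF : ∀ X, P X → P' (F.obj X)) (hG : ∀ X, P' X → P''' (G.obj X))
    (hF' : ∀ X, P X → P'' (F'.obj X)) (hG' : ∀ X, P'' X → P''' (G'.obj X))
    (e : F ⋙ G = F' ⋙ G') :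
    restrictFunctor P P' F hF ⋙ restrictFunctor P' P''' G hG =
      restrictFunctor P P'' F' hF' ⋙ restrictFunctor P'' P''' G' hG' :=
  (restrictFunctor_comp P P' P''' F G (F ⋙ G) hF hG (fun X h => hG _ (hF X h)) rfl).symm.trans
    (restrictFunctor_comp P P'' P''' F' G' (F ⋙ G) hF' hG' (fun X h => hG _ (hF X h)) e)

end restrict

namespace PointedRightDerivator
variable {𝒟 : DiagramShapes.{u}}

open DiagramShapes

/-- A square is cocartesian if it is left Kan extended from the corner: the counit
`(i_⌜)_! (i_⌜)^* F ⟶ F` is an isomorphism. -/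
def IsCocartesian (D : PointedRightDerivator 𝒟) (F : D.toPre.on 𝒟.squareShape) : Prop :=
  IsIso ((D.isRight.hasLan.adj (X := 𝒟.cornerShape) (Y := 𝒟.squareShape) cornerIncl).counit.app F)

/-- The objects of `S_n D` inside `D(Ar[n])`. -/
def sObj (D : PointedRightDerivator 𝒟) (n : ℕ) : ObjectProperty (D.toPre.on (𝒟.arShape n)) :=
  fun F =>
    (∀ i : Fin (n + 1),
      IsZero ((D.toPre.pull (Y := 𝒟.arShape n) (Shape.pt (Ar.mk i i le_rfl))).obj F)) ∧
    ∀ (i j k : Fin (n + 1)) (hij : i ≤ j) (hjk : j ≤ k),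
      D.IsCocartesian ((D.toPre.pull (X := 𝒟.squareShape) (Y := 𝒟.arShape n)
        (Ar.square i j k hij hjk)).obj F)

/-- The inverse image functor `D(Ar[n]) ⥤ D(Ar[m])` induced by `σ : [m] → [n]`. -/
abbrev arPull (D : PointedRightDerivator 𝒟) {m n : ℕ} (σ : Fin (m + 1) →o Fin (n + 1)) :
    D.toPre.on (𝒟.arShape n) ⥤ D.toPre.on (𝒟.arShape m) :=
  D.toPre.pull (X := 𝒟.arShape m) (Y := 𝒟.arShape n) (Ar.map σ)

theorem sObj_pull (D : PointedRightDerivator 𝒟) {m n : ℕ} (σ : Fin (m + 1) →o Fin (n + 1))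
    (F : D.toPre.on (𝒟.arShape n)) (hF : D.sObj n F) : D.sObj m ((D.arPull σ).obj F) := by
  refine ⟨fun i => ?_, fun i j k hij hjk => ?_⟩
  · have := hF.1 (σ i)
    have e := congrArg (fun G => G.obj F) (D.toPre.pull_comp (X := 𝒟.point) (Y := 𝒟.arShape m)
      (Z := 𝒟.arShape n) (Shape.pt (Ar.mk i i le_rfl)) (Ar.map σ))
    exact e ▸ this
  · have := hF.2 (σ i) (σ j) (σ k) (σ.monotone hij) (σ.monotone hjk)
    have e := congrArg (fun G => G.obj F) (D.toPre.pull_comp (X := 𝒟.squareShape)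
      (Y := 𝒟.arShape m) (Z := 𝒟.arShape n) (Ar.square i j k hij hjk) (Ar.map σ))
    have e' : (Ar.square.{u} i j k hij hjk) ⋙ Ar.map σ =
        Ar.square (σ i) (σ j) (σ k) (σ.monotone hij) (σ.monotone hjk) := by
      refine CategoryTheory.Functor.ext (fun p => ?_) (fun _ _ _ => Subsingleton.elim _ _)
      apply ULift.ext
      apply Subtype.ext
      apply Prod.ext
      · exact apply_ite σ _ _ _
      · exact apply_ite σ _ _ _
    rw [← e'] at this
    exact e ▸ this

/-- The simplicial category `S_• D`, with `S_n D` a full subcategory of `D(Ar[n])`. -/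
def sCat (D : PointedRightDerivator 𝒟) : SimplexCategoryᵒᵖ ⥤ Cat.{u, u} where
  obj n := Cat.of (D.sObj n.unop.len).FullSubcategory
  map σ := (restrictFunctor _ _ (D.arPull σ.unop.toOrderHom) (D.sObj_pull _)).toCatHom
  map_id _ := Cat.ext (restrictFunctor_id _ _ (D.sObj_pull _) (D.toPre.pull_id _))
  map_comp σ τ := Cat.ext (restrictFunctor_comp _ _ _ _ _ _ (D.sObj_pull _) (D.sObj_pull _)
    (D.sObj_pull _) (D.toPre.pull_comp
    (X := 𝒟.arShape _) (Y := 𝒟.arShape _) (Z := 𝒟.arShape _)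
      (Ar.map τ.unop.toOrderHom) (Ar.map σ.unop.toOrderHom)))

variable {D E : PointedRightDerivator 𝒟} (φ : D ⟶ E)

theorem Hom.isZero {Z : D.toPre.on 𝒟.point} (hZ : IsZero Z) :
    IsZero ((φ.mor.on 𝒟.point).obj Z) := by
  obtain ⟨eD⟩ := D.isRight.empty
  obtain ⟨eE⟩ := E.isRight.empty
  have init : ∀ {A : Type u} [SmallCategory A] (e : A ≌ Discrete PUnit.{u + 1}) (T : A),
      Nonempty (IsInitial T) := fun e T =>
    ⟨IsInitial.ofUniqueHom (fun _ => e.fullyFaithfulFunctor.preimage (eqToHom (by ext)))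
      fun _ _ => e.functor.map_injective (Subsingleton.elim _ _)⟩
  let p : 𝒟.empty.cat ⥤ 𝒟.point.cat := Shape.toPt 𝒟.empty
  let T : D.toPre.on 𝒟.empty := eD.inverse.obj ⟨PUnit.unit⟩
  obtain ⟨hT⟩ := init eD T
  obtain ⟨hT'⟩ := init eE ((φ.mor.on 𝒟.empty).obj T)
  have hadjD := D.isRight.hasLan.adj p
  have := hadjD.leftAdjoint_preservesColimits
  have := (E.isRight.hasLan.adj p).leftAdjoint_preservesColimits
  have h₁ : IsInitial ((D.isRight.hasLan.lan p).obj T) := hT.isInitialObj _ _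
  have h₂ : IsInitial ((E.isRight.hasLan.lan p).obj ((φ.mor.on 𝒟.empty).obj T)) :=
    hT'.isInitialObj _ _
  have := φ.isCocontinuous p
  have i₁ : (E.isRight.hasLan.lan p).obj ((φ.mor.on 𝒟.empty).obj T) ≅
      (φ.mor.on 𝒟.point).obj ((D.isRight.hasLan.lan p).obj T) :=
    asIso ((mate (D.isRight.hasLan.adj p) (E.isRight.hasLan.adj p)
      (Mor.square φ.mor p).hom).app T)
  have i₂ : (D.isRight.hasLan.lan p).obj T ≅ Z := h₁.uniqueUpToIso hZ.isInitial
  have h₃ : IsInitial ((φ.mor.on 𝒟.point).obj Z) :=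
    h₂.ofIso (i₁ ≪≫ (φ.mor.on 𝒟.point).mapIso i₂)
  have := E.isPointed.hasZero 𝒟.point
  exact (isZero_zero _).of_iso (h₃.uniqueUpToIso (isZero_zero _).isInitial)

theorem Hom.isCocartesian {F : D.toPre.on 𝒟.squareShape} (hF : D.IsCocartesian F) :
    E.IsCocartesian ((φ.mor.on 𝒟.squareShape).obj F) := by
  have := hF
  have := φ.isCocontinuous (X := 𝒟.cornerShape) (Y := 𝒟.squareShape) cornerIncl
  unfold IsCocartesian at *
  exact isIso_counit_of_mate (D.isRight.hasLan.adj (X := 𝒟.cornerShape) (Y := 𝒟.squareShape)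
    cornerIncl) (E.isRight.hasLan.adj (X := 𝒟.cornerShape) (Y := 𝒟.squareShape)
    cornerIncl) (Mor.square φ.mor (X := 𝒟.cornerShape) (Y := 𝒟.squareShape) cornerIncl).hom F

theorem Hom.comm {X Y : 𝒟.Shape} (f : X.cat ⥤ Y.cat) :
    D.toPre.pull f ⋙ φ.mor.on X = φ.mor.on Y ⋙ E.toPre.pull f :=
  congrArg Cat.Hom.toFunctor (φ.isStrict (Prederivator.cell f).op).choose

theorem Hom.sObj {n : ℕ} (F : D.toPre.on (𝒟.arShape n)) (hF : D.sObj n F) :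
    E.sObj n ((φ.mor.on (𝒟.arShape n)).obj F) := by
  refine ⟨fun i => ?_, fun i j k hij hjk => ?_⟩
  · have e := congrArg (fun G => G.obj F) (Hom.comm φ (Y := 𝒟.arShape n)
      (Shape.pt (Ar.mk i i le_rfl)))
    have := Hom.isZero φ (hF.1 i)
    exact e ▸ this
  · have e := congrArg (fun G => G.obj F) (Hom.comm φ (X := 𝒟.squareShape) (Y := 𝒟.arShape n)
      (Ar.square i j k hij hjk))
    have := Hom.isCocartesian φ (hF.2 i j k hij hjk)
    exact e ▸ this

/-- The map `S_• D ⟶ S_• E` induced by a morphism. -/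
def Hom.sMap {D E : PointedRightDerivator 𝒟} (φ : D ⟶ E) : D.sCat ⟶ E.sCat where
  app n := (restrictFunctor (D.sObj n.unop.len) (E.sObj n.unop.len)
    (φ.mor.on (𝒟.arShape n.unop.len)) (Hom.sObj φ)).toCatHom
  naturality _ _ σ := Cat.ext (restrictFunctor_square _ _ _ _ _ _ _ _ (D.sObj_pull _)
    (Hom.sObj φ) (Hom.sObj φ) (E.sObj_pull _) (Hom.comm φ (X := 𝒟.arShape _) (Y := 𝒟.arShape _)
      (Ar.map σ.unop.toOrderHom)))

/-- The functor `D ↦ S_• D` to simplicial categories. -/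
def sFunctor : PointedRightDerivator 𝒟 ⥤ SimplexCategoryᵒᵖ ⥤ Cat.{u, u} where
  obj D := D.sCat
  map φ := Hom.sMap φ
  map_id _ := rfl
  map_comp _ _ := rfl

end PointedRightDerivator

theorem const_comp_eq {J C C' : Type*} [Category* J] [Category* C] [Category* C'] (X : C)
    (F : C ⥤ C') : (Functor.const J).obj X ⋙ F = (Functor.const J).obj (F.obj X) :=
  CategoryTheory.Functor.ext (fun _ => rfl) fun _ _ _ => by simp

/-- The functor `C ↦ iso C` taking a category to its maximal subgroupoid. -/
def coreFunctor : Cat.{u, u} ⥤ Cat.{u, u} where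
  obj C := Cat.of (Core C)
  map F := F.toFunctor.core.toCatHom

/-- The diagonal of a bisimplicial set. -/
def diagonal : (SimplexCategoryᵒᵖ ⥤ SSet.{u}) ⥤ SSet.{u} where
  obj B :=
    { obj n := (B.obj n).obj n
      map f := (B.map f).app _ ≫ (B.obj _).map f }
  map φ := { app n := (φ.app n).app n }

namespace PointedRightDerivator
variable (𝒟 : DiagramShapes.{u})

/-- `Ω⁻¹ K^{W,ob}`: the functor `D ↦ s_• D`, where `s_n D` is the set of objects of `S_n D`. -/
def waldhausenK : PointedRightDerivator 𝒟 ⥤ SSet.{u} :=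
  sFunctor ⋙ (Functor.whiskeringRight _ _ _).obj Cat.objects

/-- `Ω⁻¹ K`: the functor `D ↦ diag N_• iso S_• D`. -/
def derivatorK : PointedRightDerivator 𝒟 ⥤ SSet.{u} :=
  sFunctor ⋙ (Functor.whiskeringRight _ _ _).obj (coreFunctor ⋙ nerveFunctor) ⋙ diagonal

/-- The comparison map `μ^ob`, the inclusion of objects: it sends an object of `S_n D` to the constant
string of `n` identities. -/
def comparison : waldhausenK 𝒟 ⟶ derivatorK 𝒟 where
  app D :=
    { app n := ↾fun (F : (D.sObj n.unop.len).FullSubcategory) =>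
        (Functor.const (Fin (n.unop.len + 1))).obj (Core.mk F)
      naturality m n σ := by
        ext (F : (D.sObj m.unop.len).FullSubcategory)
        exact (const_comp_eq (J := Fin (n.unop.len + 1)) (Core.mk F)
          (restrictFunctor _ _ (D.arPull σ.unop.toOrderHom) (D.sObj_pull _)).core).symm }
  naturality D E φ := by
    ext n (F : (D.sObj n.unop.len).FullSubcategory)
    exact (const_comp_eq (J := Fin (n.unop.len + 1)) (Core.mk F)
      (restrictFunctor _ _ (φ.mor.on (𝒟.arShape n.unop.len)) (Hom.sObj φ)).core).symm

end PointedRightDerivator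

/-- Weak equivalences of simplicial sets: maps `f : X ⟶ Y` such that, for every Kan complex `K`,
precomposition with `f` is a bijection `[Y, K] ⟶ [X, K]` on simplicial homotopy classes. -/
def SSetWeakEquivalences : MorphismProperty SSet.{u} := fun X Y f =>
  ∀ (K : SSet.{u}) [SSet.KanComplex K], Function.Bijective
    (Quot.map (ra := fun g h : Y ⟶ K => Nonempty (SSet.Homotopy g h))
      (rb := fun g h : X ⟶ K => Nonempty (SSet.Homotopy g h)) (fun g => f ≫ g)
      fun _ _ ⟨H⟩ => ⟨H.precomp (SSet.RelativeMorphism.botEquiv.symm f) (by simp)⟩)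

section homotopical
variable {C : Type v} [Category.{w} C]

/-- A class of weak equivalences contains the identities and has the 2-out-of-6 property. -/
structure IsHomotopical (W : MorphismProperty C) : Prop where
  id_mem : ∀ X : C, W (𝟙 X)
  two_out_of_six : ∀ ⦃X Y Z T : C⦄ (f : X ⟶ Y) (g : Y ⟶ Z) (h : Z ⟶ T),
    W (f ≫ g) → W (g ≫ h) → W f ∧ W g ∧ W h ∧ W (f ≫ g ≫ h)

/-- Functors preserving weak equivalences. -/
def IsHomotopicalFunctor (W : MorphismProperty C) (F : C ⥤ C) : Prop :=
  ∀ ⦃X Y : C⦄ (f : X ⟶ Y), W f → W (F.map f)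

/-- Functors connected by a zigzag of natural weak equivalences. -/
def NaturallyWeaklyEquivalent (W : MorphismProperty C) (F G : C ⥤ C) : Prop :=
  Relation.EqvGen (fun F G : C ⥤ C => ∃ α : F ⟶ G, ∀ X, W (α.app X)) F G

/-- Homotopically initial objects. -/
def IsHomotopicallyInitial (W : MorphismProperty C) (X : C) : Prop :=
  ∃ F₀ F₁ : C ⥤ C, IsHomotopicalFunctor W F₀ ∧ IsHomotopicalFunctor W F₁ ∧ ∃ f : F₀ ⟶ F₁,
    NaturallyWeaklyEquivalent W F₀ ((Functor.const C).obj X) ∧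
    NaturallyWeaklyEquivalent W F₁ (𝟭 C) ∧ W (f.app X)

end homotopical

section App
variable {𝒟 : DiagramShapes.{u}} (S : ObjectProperty (PointedRightDerivator 𝒟))

/-- The class `S` is closed under `D ↦ iso_n D` for all `n`. -/
def ClosedUnderIso : Prop :=
  ∀ ⦃D E : PointedRightDerivator 𝒟⦄ (n : ℕ), S D → E.toPre = D.toPre.iso n → S E

/-- The functor `F` sends equivalences of derivators to weak equivalences. -/
def SendsEquivalences (F : S.FullSubcategory ⥤ SSet.{u}) : Prop :=
  ∀ ⦃D E : S.FullSubcategory⦄ (φ : D ⟶ E), IsEquivalence φ.hom.mor →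
    SSetWeakEquivalences (F.map φ)

/-- The category of invariant approximations: the full subcategory of the comma category
`Ω⁻¹ K^{W,ob} ↓ SSet^S` on the `η : Ω⁻¹ K^{W,ob} ⟶ F` with `F` sending equivalences to weak equivalences. -/
abbrev App := ObjectProperty.FullSubcategory
  (fun η : Under (S.ι ⋙ PointedRightDerivator.waldhausenK 𝒟) => SendsEquivalences S η.right)

/-- Morphisms of `App` whose components are weak equivalences of simplicial sets. -/
def App.weakEquivalences : MorphismProperty (App S) := fun _ _ u =>
  ∀ D, SSetWeakEquivalences (u.hom.right.app D)

/-- The comparison map `μ^ob` over `S`, as an object of the comma category. -/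
def comparisonUnder : Under (S.ι ⋙ PointedRightDerivator.waldhausenK 𝒟) :=
  Under.mk (S.ι.whiskerLeft (PointedRightDerivator.comparison 𝒟))

end App

end DerivatorK

open DerivatorK

/-!
# `K`-theory of derivators is the initial invariant approximation of `K^{W,ob}`

All `K`-theories below are the deloopings of the statement, that is, `K` stands for
`diag N iso S_• D` and `K^{W,ob}` for `Ob S_• D`.

The key observation is that a string of `n` isomorphisms in `S_n D` is the same as an object of
`S_n (iso_n D)`. With `Φ F (D) = diag (n ↦ F (iso_n D))`, this gives a natural map
`κ : K ⟶ Φ K^{W,ob}` (`stringObjects`), in fact an isomorphism. The constant strings give a map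
`D ⟶ iso_n D` from the constant simplicial derivator and, for every `F`, a natural map
`c_F : F ⟶ Φ F` (`toDiagonalAlong`), with `μ ≫ κ = c_F` for `F = K^{W,ob}`.

Since `D ⟶ iso_n D` is an equivalence of prederivators, an invariant `F` sends it to a weak
equivalence, which is moreover a split monomorphism because evaluation at `0` is a retraction. The
diagonal of a levelwise acyclic monomorphism is a weak equivalence
(`sSetWeakEquivalences_diagonal_map`), so that `c_F` is a weak equivalence
(`sSetWeakEquivalences_toDiagonalAlong`). Hence `(η, F) ↦ Φ F` is a homotopical endofunctor of the
category of invariant approximations that is naturally weakly equivalent to the identity, and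
`κ ≫ Φ η : K ⟶ Φ F` is a natural transformation to it from the constant functor at `K`. It remains
to see that this morphism is a weak equivalence for `F = K`. An `n`-simplex of `Φ K (D)` is a string of
isomorphisms between strings of isomorphisms; taking its diagonal defines a map `Φ K ⟶ K`
(`diagonalString`) of which both `c_K` and `κ ≫ Φ μ` are sections. As `c_K` is a weak equivalence,
so are the retraction and the other section.

That `iso_n D` is again a pointed right derivator follows by transport along the pointwise
equivalence `iso_n D ⟶ D` (`IsRightDerivator.of_isEquivalence`), which rests on the fact that the
mate of an isomorphism along equivalences is an isomorphism (`isIso_mate_of_isEquivalence`). That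
`K` is invariant (`sSetWeakEquivalences_derivatorK_map`) reduces to the statement that a levelwise
equivalence of simplicial categories induces a weak equivalence on the diagonals of the nerves: it
factors through a graph construction into functors that are injective on objects and a retraction of
such, to which the result on diagonals applies.

A weak equivalence of simplicial sets is a map that induces bijections on homotopy classes of maps
to all Kan complexes. The acyclic monomorphisms `i : A ⟶ B` are those monomorphisms for which
`K ^ B ⟶ K ^ A` lifts against all monomorphisms for all Kan complexes `K`
(`SSetWeakEquivalences.rlp_pre`, `SSetWeakEquivalences.of_rlp_pre`). By adjunction this is a left
lifting property of `i` (`KanRestrictions.llp_iff`), so that acyclic monomorphisms are stable under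
pushouts, transfinite compositions and pushout-products with inclusions. The result on diagonals
follows by filtering the diagonal by horizontal skeleta.
-/

namespace DerivatorK

/-! ### Homotopies along Kan fibrations -/

section SimplicialHomotopy

open MonoidalCategory CartesianMonoidalCategory HomotopicalAlgebra SSet SSet.modelCategoryQuillen

theorem whiskerLeft_const (T : SSet.{u}) {A B : SSet.{u}} (b : B _⦋0⦌) :
    T ◁ (SSet.const b : A ⟶ B) = fst T A ≫ lift (𝟙 T) (SSet.const b) := rfl

theorem lift_const_whiskerLeft (T : SSet.{u}) {A B : SSet.{u}} (a : A _⦋0⦌) (g : A ⟶ B) :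
    lift (𝟙 T) (SSet.const a) ≫ T ◁ g = lift (𝟙 T) (SSet.const (g.app _ a)) := by
  ext n x
  · rfl
  · exact (NatTrans.naturality_apply g _ a)

theorem ι₀_whiskerLeft (T : SSet.{u}) {B : SSet.{u}} (g : Δ[1] ⟶ B) :
    ι₀ ≫ T ◁ g = lift (𝟙 T) (SSet.const (g.app _ (stdSimplex.obj₀Equiv.{u}.symm 0))) :=
  lift_const_whiskerLeft ..

theorem ι₁_whiskerLeft (T : SSet.{u}) {B : SSet.{u}} (g : Δ[1] ⟶ B) :
    ι₁ ≫ T ◁ g = lift (𝟙 T) (SSet.const (g.app _ (stdSimplex.obj₀Equiv.{u}.symm 1))) :=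
  lift_const_whiskerLeft ..

theorem stdSimplex_δ_zero_eq_const :
    (stdSimplex.{u}.δ (0 : Fin 2)) = SSet.const (stdSimplex.obj₀Equiv.{u}.symm 1) := by
  apply yonedaEquiv.injective
  apply stdSimplex.obj₀Equiv.injective
  decide

theorem horn_one_ι : (Λ[1, 1] : (Δ[1] : SSet.{u}).Subcomplex).ι =
    SSet.const (stdSimplex.obj₀Equiv.{u}.symm 1) := by
  apply horn.hom_ext'
  intro j hj
  obtain rfl : j = 0 := by fin_cases j <;> simp_all
  rw [horn.ι_ι, stdSimplex_δ_zero_eq_const]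
  rfl

theorem horn₂₂_isPushout_whiskerLeft (T : SSet.{u}) :
    IsPushout (T ◁ stdSimplex.{u}.δ (0 : Fin 2)) (T ◁ stdSimplex.{u}.δ (0 : Fin 2))
      (T ◁ horn₂₂.ι₀₂.{u}) (T ◁ horn₂₂.ι₁₂.{u}) :=
  horn₂₂.isPushout.{u}.map (tensorLeft T)

theorem whiskerLeft_horn_ι (T : SSet.{u}) {n : ℕ} (i j : Fin (n + 2)) (h : j ≠ i) :
    T ◁ horn.ι.{u} i j h ≫ T ◁ Λ[n + 1, i].ι = T ◁ stdSimplex.δ j := by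
  rw [← MonoidalCategory.whiskerLeft_comp, horn.ι_ι]

/-- Filling of a `Λ[2, 2]`-shaped diagram of homotopies, relative to a Kan fibration: the homotopies
`a` and `b` with a common end lie over two faces of `s`, and the third face of the lift of `s` is a
homotopy from the start of `a` to the start of `b`. -/
theorem exists_homotopy_lift {T E B : SSet.{u}} (p : E ⟶ B) [Fibration p] (a b : T ⊗ Δ[1] ⟶ E)
    (s : T ⊗ Δ[2] ⟶ B) (h : ι₁ ≫ a = ι₁ ≫ b) (ha : T ◁ stdSimplex.δ 1 ≫ s = a ≫ p)
    (hb : T ◁ stdSimplex.δ 0 ≫ s = b ≫ p) :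
    ∃ c : T ⊗ Δ[1] ⟶ E, ι₀ ≫ c = ι₀ ≫ a ∧ ι₁ ≫ c = ι₀ ≫ b ∧
      c ≫ p = T ◁ stdSimplex.δ 2 ≫ s := by
  have sq := horn₂₂_isPushout_whiskerLeft T
  have hab : T ◁ stdSimplex.{u}.δ (0 : Fin 2) ≫ a = T ◁ stdSimplex.{u}.δ (0 : Fin 2) ≫ b := by
    rw [stdSimplex_δ_zero_eq_const, whiskerLeft_const]
    exact congrArg (fst T _ ≫ ·) h
  obtain ⟨d, e₀₂, e₁₂⟩ : ∃ d, T ◁ horn₂₂.ι₀₂.{u} ≫ d = a ∧ T ◁ horn₂₂.ι₁₂.{u} ≫ d = b :=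
    ⟨sq.desc a b hab, sq.inl_desc _ _ hab, sq.inr_desc _ _ hab⟩
  have comm : d ≫ p = T ◁ Λ[2, 2].ι ≫ s := by
    apply sq.hom_ext
    · rw [reassoc_of% e₀₂, ← ha, ← whiskerLeft_horn_ι T 2 1 (by simp), Category.assoc]
    · rw [reassoc_of% e₁₂, ← hb, ← whiskerLeft_horn_ι T 2 0 (by simp), Category.assoc]
  have := anodyneExtensions.whiskerLeft (anodyneExtensions.horn_ι.{u} (2 : Fin 3)) T p
    (mem_fibrations p)
  obtain ⟨l, hl, hl'⟩ : ∃ l, T ◁ Λ[2, 2].ι ≫ l = d ∧ l ≫ p = s :=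
    let csq : CommSq d (T ◁ Λ[2, 2].ι) p s := ⟨comm⟩
    ⟨csq.lift, csq.fac_left, csq.fac_right⟩
  have f₁ : T ◁ stdSimplex.δ 1 ≫ l = a := by
    rw [← e₀₂, ← hl, ← whiskerLeft_horn_ι T 2 1 (by simp), Category.assoc]
  have f₀ : T ◁ stdSimplex.δ 0 ≫ l = b := by
    rw [← e₁₂, ← hl, ← whiskerLeft_horn_ι T 2 0 (by simp), Category.assoc]
  refine ⟨T ◁ stdSimplex.δ 2 ≫ l, ?_, ?_, by rw [Category.assoc, hl']⟩
  · rw [← f₁, ← Category.assoc, ← Category.assoc, ι₀_whiskerLeft, ι₀_whiskerLeft]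
    congr 3
  · rw [← f₀, ← Category.assoc, ← Category.assoc, ι₀_whiskerLeft, ι₁_whiskerLeft]
    congr 3

/-- The homotopy lifting property of a Kan fibration, relative to a subcomplex. -/
theorem exists_lift_of_fibration {V E B : SSet.{u}} (S : V.Subcomplex) (p : E ⟶ B) [Fibration p]
    (v : V ⟶ E) (h : (S : SSet) ⊗ Δ[1] ⟶ E) (k : V ⊗ Δ[1] ⟶ B) (hv : ι₁ ≫ h = S.ι ≫ v)
    (hk : ι₁ ≫ k = v ≫ p) (hh : S.ι ▷ Δ[1] ≫ k = h ≫ p) :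
    ∃ H : V ⊗ Δ[1] ⟶ E, ι₁ ≫ H = v ∧ S.ι ▷ Δ[1] ≫ H = h ∧ H ≫ p = k := by
  have sq := Subcomplex.unionProd.isPushout S (Λ[1, 1] : (Δ[1] : SSet.{u}).Subcomplex)
  have c : S.ι ▷ ((Λ[1, 1] : (Δ[1] : SSet.{u}).Subcomplex) : SSet) ≫ fst _ _ ≫ v =
      (S : SSet) ◁ (Λ[1, 1] : (Δ[1] : SSet.{u}).Subcomplex).ι ≫ h := by
    rw [horn_one_ι, whiskerLeft_const, Category.assoc]
    change _ = fst _ _ ≫ ι₁ ≫ h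
    rw [hv]
    rfl
  have := anodyneExtensions_unionProd_ι S _ (anodyneExtensions.horn_ι.{u} (1 : Fin 2)) p
    (mem_fibrations p)
  have comm : sq.desc _ _ c ≫ p = (Subcomplex.unionProd S Λ[1, 1]).ι ≫ k := by
    apply sq.hom_ext
    · rw [sq.inl_desc_assoc, Category.assoc, ← hk, Subcomplex.unionProd.ι₁_ι_assoc, horn_one_ι]
      rfl
    · rw [sq.inr_desc_assoc, Subcomplex.unionProd.ι₂_ι_assoc, hh]
  obtain ⟨H, hH, hH'⟩ : ∃ H, (Subcomplex.unionProd S Λ[1, 1]).ι ≫ H = sq.desc _ _ c ∧ H ≫ p = k :=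
    let csq : CommSq _ _ p k := ⟨comm⟩
    ⟨csq.lift, csq.fac_left, csq.fac_right⟩
  have e₁ : V ◁ (Λ[1, 1] : (Δ[1] : SSet.{u}).Subcomplex).ι ≫ H = fst _ _ ≫ v := by
    rw [← Subcomplex.unionProd.ι₁_ι_assoc, hH, sq.inl_desc]
  have e₂ : S.ι ▷ Δ[1] ≫ H = h := by
    rw [← Subcomplex.unionProd.ι₂_ι_assoc, hH, sq.inr_desc]
  refine ⟨H, ?_, e₂, hH'⟩
  rw [horn_one_ι, whiskerLeft_const, Category.assoc] at e₁
  let x : (Λ[1, 1] : (Δ[1] : SSet.{u}).Subcomplex).toSSet _⦋0⦌ :=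
    (horn.ι.{u} (1 : Fin 2) 0 (by simp)).app _ (stdSimplex.obj₀Equiv.symm 0)
  have e₃ := congrArg (lift (𝟙 V) (SSet.const x) ≫ ·) e₁
  exact e₃

end SimplicialHomotopy

section SimplicialHomotopy

open MonoidalCategory CartesianMonoidalCategory HomotopicalAlgebra SSet SSet.modelCategoryQuillen

/-- Two maps of simplicial sets are homotopic if there is a single homotopy from the first to the
second. -/
def Homotopic {X Y : SSet.{u}} (f g : X ⟶ Y) : Prop := Nonempty (SSet.Homotopy f g)

theorem homotopic_iff {X Y : SSet.{u}} {f g : X ⟶ Y} :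
    Homotopic f g ↔ ∃ H : X ⊗ Δ[1] ⟶ Y, ι₀ ≫ H = f ∧ ι₁ ≫ H = g := by
  constructor
  · rintro ⟨H⟩
    exact ⟨H.h, H.h₀, H.h₁⟩
  · rintro ⟨H, h₀, h₁⟩
    exact ⟨{ h := H, h₀ := h₀, h₁ := h₁, rel := by ext n x; exact x.1.2.elim }⟩

namespace Homotopic

variable {X Y Z : SSet.{u}}

theorem refl (f : X ⟶ Y) : Homotopic f f := ⟨SSet.RelativeMorphism.Homotopy.refl _⟩

theorem comp_right {f g : X ⟶ Y} (h : Homotopic f g) (k : Y ⟶ Z) :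
    Homotopic (f ≫ k) (g ≫ k) := by
  rw [homotopic_iff] at *
  obtain ⟨H, rfl, rfl⟩ := h
  exact ⟨H ≫ k, by simp, by simp⟩

theorem comp_left {f g : Y ⟶ Z} (k : X ⟶ Y) (h : Homotopic f g) :
    Homotopic (k ≫ f) (k ≫ g) := by
  rw [homotopic_iff] at *
  obtain ⟨H, rfl, rfl⟩ := h
  exact ⟨k ▷ _ ≫ H, by simp, by simp⟩

/-- Two homotopies with a common end form a horn `Λ[2, 2]`; symmetry and transitivity follow. -/
theorem join [KanComplex Y] {f g h : X ⟶ Y} (hf : Homotopic f h) (hg : Homotopic g h) :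
    Homotopic f g := by
  rw [homotopic_iff] at *
  obtain ⟨a, rfl, ha⟩ := hf
  obtain ⟨b, rfl, hb⟩ := hg
  obtain ⟨c, h₀, h₁, -⟩ := exists_homotopy_lift (terminal.from Y) a b (terminal.from _)
    (ha.trans hb.symm) (by simp) (by simp)
  exact ⟨c, h₀, h₁⟩

theorem symm [KanComplex Y] {f g : X ⟶ Y} (h : Homotopic f g) : Homotopic g f :=
  (refl g).join h

theorem trans [KanComplex Y] {f g h : X ⟶ Y} (h₁ : Homotopic f g) (h₂ : Homotopic g h) :
    Homotopic f h :=
  h₁.join h₂.symm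

theorem equivalence [KanComplex Y] : _root_.Equivalence (Homotopic (X := X) (Y := Y)) :=
  ⟨refl, symm, trans⟩

end Homotopic

/-- The homotopy lifting property of a Kan fibration, starting from the end of the homotopy. -/
theorem exists_lift_homotopy {V E B : SSet.{u}} (p : E ⟶ B) [Fibration p]
    (v : V ⟶ E) (k : V ⊗ Δ[1] ⟶ B) (hk : ι₁ ≫ k = v ≫ p) :
    ∃ H : V ⊗ Δ[1] ⟶ E, ι₁ ≫ H = v ∧ H ≫ p = k := by
  obtain ⟨H, h₁, -, h₂⟩ := exists_lift_of_fibration (⊥ : V.Subcomplex) p v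
    (fst _ _ ≫ Subcomplex.isInitialBot.to E) k (by ext n x; exact x.2.elim) hk
    (by ext n x; exact x.1.2.elim)
  exact ⟨H, h₁, h₂⟩

/-- A Kan fibration between Kan complexes that induces bijections on homotopy classes of maps lifts
against all monomorphisms. A section `s` exists by homotopy lifting; a homotopy `H` from the
identity to `p ≫ s` is corrected to a fibrewise one by lifting the degenerate `2`-simplex on `H ≫
p` along the horn with edges `H` and `H ≫ p ≫ s`; lifts are then obtained by sliding along this
fibrewise homotopy. -/
theorem rlp_monomorphisms_of_bijective {E B : SSet.{u}} (p : E ⟶ B) [Fibration p]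
    (inj : ∀ ⦃T : SSet.{u}⦄ (f g : T ⟶ E), Homotopic (f ≫ p) (g ≫ p) → Homotopic f g)
    (surj : ∀ ⦃T : SSet.{u}⦄ (g : T ⟶ B), ∃ f : T ⟶ E, Homotopic g (f ≫ p)) :
    (MorphismProperty.monomorphisms SSet.{u}).rlp p := by
  obtain ⟨s, hs⟩ : ∃ s : B ⟶ E, s ≫ p = 𝟙 B := by
    obtain ⟨f, hf⟩ := surj (𝟙 B)
    obtain ⟨k, hk₀, hk₁⟩ := homotopic_iff.1 hf
    obtain ⟨H, h₁, h₂⟩ := exists_lift_homotopy p f k hk₁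
    exact ⟨ι₀ ≫ H, by rw [Category.assoc, h₂, hk₀]⟩
  obtain ⟨H, H₀, H₁⟩ := homotopic_iff.1 (inj (𝟙 E) (p ≫ s) (by
    rw [Category.assoc, hs, Category.id_comp, Category.comp_id]; exact .refl _))
  obtain ⟨c, c₀, c₁, hc⟩ := exists_homotopy_lift p H (H ≫ p ≫ s)
    (E ◁ stdSimplex.σ 0 ≫ H ≫ p) (by rw [reassoc_of% H₁, H₁, reassoc_of% hs])
    (by
      rw [← MonoidalCategory.whiskerLeft_comp_assoc]
      erw [stdSimplex.δ_comp_σ_succ (i := (0 : Fin 2))]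
      simp)
    (by
      rw [← MonoidalCategory.whiskerLeft_comp_assoc]
      erw [stdSimplex.δ_comp_σ_self (i := (0 : Fin 2))]
      simp [hs])
  -- The homotopy `c` from `𝟙 E` to `p ≫ s` is constant after composition with `p`.
  rw [H₀] at c₀
  rw [reassoc_of% H₀] at c₁
  have hσ : (stdSimplex.{u}.δ (2 : Fin 3)) ≫ stdSimplex.σ (0 : Fin 2) =
      SSet.const (stdSimplex.obj₀Equiv.{u}.symm 0) := by
    apply yonedaEquiv.injective
    ext i
    fin_cases i <;> rfl
  have hc' : c ≫ p = fst _ _ ≫ p := by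
    rw [hc, ← MonoidalCategory.whiskerLeft_comp_assoc, hσ, whiskerLeft_const, Category.assoc]
    congr 1
    exact (reassoc_of% H₀) p
  rw [rlp_monomorphisms]
  rintro _ _ _ ⟨n⟩
  refine ⟨fun {top bot} sq => ?_⟩
  obtain ⟨l, l₁, l₂, l₃⟩ := exists_lift_of_fibration ∂Δ[n] p (bot ≫ s) (top ▷ _ ≫ c)
    (fst _ _ ≫ bot) (by rw [ι₁_comp_assoc, c₁, reassoc_of% sq.w])
    (by rw [Category.assoc, hs, Category.comp_id]; rfl)
    (by rw [Category.assoc, hc']; exact congrArg (fst _ _ ≫ ·) sq.w.symm)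
  refine ⟨⟨{ l := ι₀ ≫ l, fac_left := ?_, fac_right := ?_ }⟩⟩
  · rw [← ι₀_comp_assoc, l₂, ι₀_comp_assoc, c₀, Category.comp_id]
  · rw [Category.assoc, l₃]
    rfl

/-! ### Weak equivalences of simplicial sets -/

/-- On maps to a Kan complex homotopy is an equivalence relation, so that the classes of maps can be
replaced by the maps themselves. -/
theorem sSetWeakEquivalences_iff {X Y : SSet.{u}} (f : X ⟶ Y) :
    SSetWeakEquivalences f ↔ ∀ (K : SSet.{u}) [KanComplex K],
      (∀ g g' : Y ⟶ K, Homotopic (f ≫ g) (f ≫ g') → Homotopic g g') ∧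
      (∀ g : X ⟶ K, ∃ g' : Y ⟶ K, Homotopic g (f ≫ g')) := by
  refine forall₂_congr fun K _ => and_congr ?_ ?_
  · constructor
    · intro h g g' H
      exact Homotopic.equivalence.quot_mk_eq_iff _ _ |>.1
        (h (a₁ := Quot.mk _ g) (a₂ := Quot.mk _ g') (Quot.sound H))
    · rintro h ⟨g⟩ ⟨g'⟩ H
      exact Quot.sound (h g g' (Homotopic.equivalence.quot_mk_eq_iff _ _ |>.1 H))
  · constructor
    · intro h g
      obtain ⟨⟨g'⟩, H⟩ := h (Quot.mk _ g)
      exact ⟨g', Homotopic.equivalence.quot_mk_eq_iff _ _ |>.1 H.symm⟩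
    · rintro h ⟨g⟩
      obtain ⟨g', H⟩ := h g
      exact ⟨Quot.mk _ g', Quot.sound H.symm⟩

/-- The map on homotopy classes of maps to `K` induced by precomposition with `f`. -/
def homotopyClassMap (K : SSet.{u}) {X Y : SSet.{u}} (f : X ⟶ Y) :
    Quot (Homotopic (X := Y) (Y := K)) → Quot (Homotopic (X := X) (Y := K)) :=
  Quot.map (f ≫ ·) fun _ _ h => h.comp_left f

theorem homotopyClassMap_comp (K : SSet.{u}) {X Y Z : SSet.{u}} (f : X ⟶ Y) (g : Y ⟶ Z) :
    homotopyClassMap K (f ≫ g) = homotopyClassMap K f ∘ homotopyClassMap K g := by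
  ext ⟨a⟩
  exact congrArg (Quot.mk _) (Category.assoc f g a)

theorem sSetWeakEquivalences_iff_bijective {X Y : SSet.{u}} (f : X ⟶ Y) :
    SSetWeakEquivalences f ↔
      ∀ (K : SSet.{u}) [KanComplex K], Function.Bijective (homotopyClassMap K f) :=
  Iff.rfl

theorem isHomotopical_sSetWeakEquivalences : IsHomotopical SSetWeakEquivalences.{u} where
  id_mem X K _ := by
    refine ⟨?_, ?_⟩
    · rintro ⟨a⟩ ⟨b⟩ h
      exact h
    · rintro ⟨a⟩
      exact ⟨Quot.mk _ a, rfl⟩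
  two_out_of_six X Y Z T f g h hfg hgh := by
    simp only [sSetWeakEquivalences_iff_bijective, homotopyClassMap_comp, ← forall_and] at *
    intro K _
    have hg : Function.Bijective (homotopyClassMap K g) :=
      ⟨(hfg K).1.of_comp, (hgh K).2.of_comp⟩
    have hf := (Function.Bijective.of_comp_iff _ hg).1 (hfg K)
    have hh := (Function.Bijective.of_comp_iff' hg _).1 (hgh K)
    exact ⟨hf, hg, hh, hf.comp (hg.comp hh)⟩

namespace SSetWeakEquivalences

variable {X Y Z : SSet.{u}} {f : X ⟶ Y} {g : Y ⟶ Z}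

theorem comp (hf : SSetWeakEquivalences f) (hg : SSetWeakEquivalences g) :
    SSetWeakEquivalences (f ≫ g) := by
  simp only [sSetWeakEquivalences_iff_bijective, homotopyClassMap_comp] at *
  exact fun K _ => (hf K).comp (hg K)

theorem of_comp_left (hf : SSetWeakEquivalences f) (hfg : SSetWeakEquivalences (f ≫ g)) :
    SSetWeakEquivalences g := by
  simp only [sSetWeakEquivalences_iff_bijective, homotopyClassMap_comp] at *
  exact fun K _ => (Function.Bijective.of_comp_iff' (hf K) _).1 (hfg K)

theorem of_comp_right (hg : SSetWeakEquivalences g) (hfg : SSetWeakEquivalences (f ≫ g)) :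
    SSetWeakEquivalences f := by
  simp only [sSetWeakEquivalences_iff_bijective, homotopyClassMap_comp] at *
  exact fun K _ => (Function.Bijective.of_comp_iff _ (hg K)).1 (hfg K)

theorem of_homotopyEquiv {f : X ⟶ Y} (g : Y ⟶ X) (hfg : Homotopic (f ≫ g) (𝟙 X))
    (hgf : Homotopic (g ≫ f) (𝟙 Y)) : SSetWeakEquivalences f := by
  rw [sSetWeakEquivalences_iff]
  intro K _
  constructor
  · intro a b h
    have ha := hgf.comp_right a
    have hb := hgf.comp_right b
    have := h.comp_left g
    simp only [Category.assoc, Category.id_comp] at ha hb this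
    exact ha.symm.trans (this.trans hb)
  · intro a
    have := hfg.comp_right a
    simp only [Category.assoc, Category.id_comp] at this
    exact ⟨g ≫ a, this.symm⟩

theorem of_isIso (f : X ⟶ Y) [IsIso f] : SSetWeakEquivalences f :=
  of_homotopyEquiv (inv f) (by simpa using .refl _) (by simpa using .refl _)

theorem arrow_mk_iso_iff {X' Y' : SSet.{u}} {f : X ⟶ Y} {f' : X' ⟶ Y'}
    (e : X ≅ X') (e' : Y ≅ Y') (h : f ≫ e'.hom = e.hom ≫ f') :
    SSetWeakEquivalences f ↔ SSetWeakEquivalences f' :=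
  ⟨fun hf => of_comp_left (of_isIso e.hom) (h ▸ hf.comp (of_isIso e'.hom)),
    fun hf => of_comp_right (of_isIso e'.hom) (h ▸ (of_isIso e.hom).comp hf)⟩

end SSetWeakEquivalences

/-! ### Acyclic monomorphisms -/

theorem homotopic_curry_iff {A T K : SSet.{u}} (f g : A ⊗ T ⟶ K) :
    Homotopic (MonoidalClosed.curry f) (MonoidalClosed.curry g) ↔ Homotopic f g := by
  rw [homotopic_iff, homotopic_iff]
  constructor
  · rintro ⟨H, h₀, h₁⟩
    refine ⟨(α_ A T Δ[1]).hom ≫ MonoidalClosed.uncurry H, ?_, ?_⟩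
    · have : A ◁ ι₀ ≫ MonoidalClosed.uncurry H = f := by
        rw [← MonoidalClosed.uncurry_natural_left, h₀, MonoidalClosed.uncurry_curry]
      exact this
    · have : A ◁ ι₁ ≫ MonoidalClosed.uncurry H = g := by
        rw [← MonoidalClosed.uncurry_natural_left, h₁, MonoidalClosed.uncurry_curry]
      exact this
  · rintro ⟨H, h₀, h₁⟩
    refine ⟨MonoidalClosed.curry ((α_ A T Δ[1]).inv ≫ H), ?_, ?_⟩
    · rw [← MonoidalClosed.curry_natural_left]
      exact congrArg _ h₀
    · rw [← MonoidalClosed.curry_natural_left]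
      exact congrArg _ h₁

/-- By currying, maps `T ⊗ B ⟶ K` are maps from `B` to the Kan complex `K ^ T`. -/
theorem SSetWeakEquivalences.whiskerRight {A B : SSet.{u}} {i : A ⟶ B}
    (hi : SSetWeakEquivalences i) (T : SSet.{u}) : SSetWeakEquivalences (i ▷ T) := by
  have key : ∀ {K : SSet.{u}} (f : T ⊗ B ⟶ K), i ≫ MonoidalClosed.curry f =
      MonoidalClosed.curry (T ◁ i ≫ f) := fun f => (MonoidalClosed.curry_natural_left ..).symm
  rw [arrow_mk_iso_iff (β_ A T) (β_ B T) (f' := T ◁ i) (by simp)]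
  rw [sSetWeakEquivalences_iff] at hi ⊢
  intro K _
  constructor
  · intro a b h
    rw [← homotopic_curry_iff] at h ⊢
    rw [← key, ← key] at h
    exact (hi _).1 _ _ h
  · intro a
    obtain ⟨b, hb⟩ := (hi ((ihom T).obj K)).2 (MonoidalClosed.curry a)
    refine ⟨MonoidalClosed.uncurry b, ?_⟩
    rwa [← homotopic_curry_iff, ← key, MonoidalClosed.curry_uncurry]

/-- For an acyclic monomorphism `i : A ⟶ B` and a Kan complex `K`, the restriction `K ^ B ⟶ K ^ A`
lifts against all monomorphisms. -/
theorem SSetWeakEquivalences.rlp_pre {A B : SSet.{u}} {i : A ⟶ B} [Mono i]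
    (hi : SSetWeakEquivalences i) (K : SSet.{u}) [KanComplex K] :
    (MorphismProperty.monomorphisms SSet.{u}).rlp ((MonoidalClosed.pre i).app K) := by
  have key : ∀ {T : SSet.{u}} (f : B ⊗ T ⟶ K), MonoidalClosed.curry f ≫
      (MonoidalClosed.pre i).app K = MonoidalClosed.curry (i ▷ T ≫ f) := fun f =>
    MonoidalClosed.curry_pre_app ..
  have H := fun T => sSetWeakEquivalences_iff _ |>.1 (hi.whiskerRight T) K
  refine rlp_monomorphisms_of_bijective _ (fun T a b h => ?_) (fun T a => ?_)
  · obtain ⟨a, rfl⟩ : ∃ a', MonoidalClosed.curry a' = a := ⟨_, MonoidalClosed.curry_uncurry a⟩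
    obtain ⟨b, rfl⟩ : ∃ b', MonoidalClosed.curry b' = b := ⟨_, MonoidalClosed.curry_uncurry b⟩
    rw [key, key, homotopic_curry_iff] at h
    rw [homotopic_curry_iff]
    exact (H T).1 _ _ h
  · obtain ⟨a, rfl⟩ : ∃ a', MonoidalClosed.curry a' = a := ⟨_, MonoidalClosed.curry_uncurry a⟩
    obtain ⟨b, hb⟩ := (H T).2 a
    refine ⟨MonoidalClosed.curry b, ?_⟩
    rwa [key, homotopic_curry_iff]

/-- A map that lifts against all monomorphisms reflects homotopies: a homotopy `H` is lifted along
the inclusion of the two ends of the cylinder on `V`. -/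
theorem exists_lift_homotopic {V E B : SSet.{u}} {p : E ⟶ B}
    (hp : (MorphismProperty.monomorphisms SSet.{u}).rlp p) {f g : V ⟶ E}
    (h : Homotopic (f ≫ p) (g ≫ p)) : Homotopic f g := by
  obtain ⟨H, h₀, h₁⟩ := homotopic_iff.1 h
  have inf : Subcomplex.range (ι₀ (X := V)) ⊓ Subcomplex.range (ι₁ (X := V)) = ⊥ := by
    rw [eq_bot_iff]
    rintro ⟨⟨n⟩⟩ x ⟨⟨y, rfl⟩, z, hz⟩
    have := congrArg (fun t : (V ⊗ Δ[1] : SSet.{u}) _⦋n⦌ => (t.2 : Δ[1] _⦋n⦌) 0) hz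
    exact absurd this (by simp)
  let sq : Subcomplex.BicartSq ⊥ (Subcomplex.range (ι₀ (X := V)))
    (Subcomplex.range (ι₁ (X := V))) _ := ⟨rfl, inf⟩
  have po := sq.isPushout
  have m₀ : Mono (ι₀ (X := V)) := mono_of_mono_fac (ι₀_fst V)
  have m₁ : Mono (ι₁ (X := V)) := mono_of_mono_fac (ι₁_fst V)
  have w : Subcomplex.homOfLE sq.le₁₂ ≫ (Subcomplex.range (ι₀ (X := V))).ι ≫ fst _ _ ≫ f =
      Subcomplex.homOfLE sq.le₁₃ ≫ (Subcomplex.range (ι₁ (X := V))).ι ≫ fst _ _ ≫ g :=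
    Subcomplex.isInitialBot.hom_ext _ _
  have e₀ : (Subcomplex.range (ι₀ (X := V))).ι ≫ H =
      (Subcomplex.range (ι₀ (X := V))).ι ≫ fst _ _ ≫ f ≫ p := by
    rw [← h₀, ← cancel_epi (Subcomplex.toRange ι₀)]
    rfl
  have e₁ : (Subcomplex.range (ι₁ (X := V))).ι ≫ H =
      (Subcomplex.range (ι₁ (X := V))).ι ≫ fst _ _ ≫ g ≫ p := by
    rw [← h₁, ← cancel_epi (Subcomplex.toRange ι₁)]
    rfl
  have := hp (Subcomplex.range (ι₀ (X := V)) ⊔ Subcomplex.range (ι₁ (X := V))).ι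
    (MorphismProperty.monomorphisms.infer_property _)
  let csq : CommSq (po.desc _ _ w)
      (Subcomplex.range (ι₀ (X := V)) ⊔ Subcomplex.range (ι₁ (X := V))).ι p H := ⟨by
    apply po.hom_ext
    · rw [po.inl_desc_assoc, Category.assoc, Category.assoc, ← e₀]
      rfl
    · rw [po.inr_desc_assoc, Category.assoc, Category.assoc, ← e₁]
      rfl⟩
  refine homotopic_iff.2 ⟨csq.lift, ?_, ?_⟩
  · have := congrArg (fun t => Subcomplex.toRange ι₀ ≫ Subcomplex.homOfLE sq.le₂₄ ≫ t) csq.fac_left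
    exact this.trans (congrArg (Subcomplex.toRange ι₀ ≫ ·) (po.inl_desc _ _ w))
  · have := congrArg (fun t => Subcomplex.toRange ι₁ ≫ Subcomplex.homOfLE sq.le₃₄ ≫ t) csq.fac_left
    exact this.trans (congrArg (Subcomplex.toRange ι₁ ≫ ·) (po.inr_desc _ _ w))

/-- The converse of `SSetWeakEquivalences.rlp_pre`: maps `A ⟶ K` are maps from the point to `K ^ A`,
and they are lifted to `K ^ B` along the inclusion of the empty simplicial set into the point. -/
theorem SSetWeakEquivalences.of_rlp_pre {A B : SSet.{u}} (i : A ⟶ B)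
    (h : ∀ (K : SSet.{u}) [KanComplex K],
      (MorphismProperty.monomorphisms SSet.{u}).rlp ((MonoidalClosed.pre i).app K)) :
    SSetWeakEquivalences i := by
  rw [arrow_mk_iso_iff (ρ_ A).symm (ρ_ B).symm (f' := i ▷ 𝟙_ _) (by simp),
    sSetWeakEquivalences_iff]
  intro K _
  constructor
  · intro a b H
    rw [← homotopic_curry_iff] at H ⊢
    refine exists_lift_homotopic (h K) ?_
    rwa [MonoidalClosed.curry_pre_app, MonoidalClosed.curry_pre_app]
  · intro a
    have := h K (initial.to (𝟙_ SSet.{u})) (MorphismProperty.monomorphisms.infer_property _)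
    let sq : CommSq (initial.to _) (initial.to (𝟙_ SSet.{u})) ((MonoidalClosed.pre i).app K)
      (MonoidalClosed.curry a) := ⟨initialIsInitial.hom_ext _ _⟩
    refine ⟨MonoidalClosed.uncurry sq.lift, ?_⟩
    have e := sq.fac_right
    rw [← MonoidalClosed.curry_uncurry sq.lift, MonoidalClosed.curry_pre_app] at e
    rw [MonoidalClosed.curry_injective e]
    exact .refl _

/-- The restriction maps `K ^ V ⟶ K ^ U` along monomorphisms `U ⟶ V`, for Kan complexes `K`. -/
inductive KanRestrictions : MorphismProperty SSet.{u} where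
  | mk {U V : SSet.{u}} (j : U ⟶ V) [Mono j] (K : SSet.{u}) [KanComplex K] :
    KanRestrictions ((MonoidalClosed.pre j).app K)

/-- Both lifting properties say that `K` has the extension property with respect to the
pushout-product of `i` and `j`, which is symmetric in `i` and `j`. -/
theorem hasLiftingProperty_pre_iff {A B U V : SSet.{u}} (i : A ⟶ B) (j : U ⟶ V) (K : SSet.{u}) :
    HasLiftingProperty i ((MonoidalClosed.pre j).app K) ↔
      HasLiftingProperty j ((MonoidalClosed.pre i).app K) := by
  have key : ∀ {A B U V : SSet.{u}} (i : A ⟶ B) (j : U ⟶ V)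
      (sq : (curriedTensor SSet).PushoutObjObj i j),
      HasLiftingProperty sq.ι (terminal.from K) ↔
        HasLiftingProperty j ((MonoidalClosed.pre i).app K) := fun i j sq =>
    MonoidalClosed.internalHomAdjunction₂.hasLiftingProperty_iff sq
      (Functor.PullbackObjObj.ofIsTerminal MonoidalClosed.internalHom i (terminal.from K)
        terminalIsTerminal)
  let sq := Functor.PushoutObjObj.ofHasPushout (curriedTensor SSet) i j
  rw [← key i j sq, ← key j i sq.flipTensor]
  exact HasLiftingProperty.iff_of_arrow_iso_left
    (show Arrow.mk sq.flipTensor.ι ≅ Arrow.mk sq.ι from Arrow.isoMk (Iso.refl _) (β_ _ _)) _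

/-- Together with `SSetWeakEquivalences.rlp_pre` and `SSetWeakEquivalences.of_rlp_pre` this
identifies the acyclic monomorphisms by a left lifting property, so that they are stable under
pushouts and transfinite compositions. -/
theorem KanRestrictions.llp_iff {A B : SSet.{u}} (i : A ⟶ B) :
    KanRestrictions.{u}.llp i ↔ ∀ (K : SSet.{u}) [KanComplex K],
      (MorphismProperty.monomorphisms SSet.{u}).rlp ((MonoidalClosed.pre i).app K) := by
  constructor
  · intro h K _ U V j hj
    have : Mono j := hj
    exact (hasLiftingProperty_pre_iff _ _ _).1 (h _ ⟨j, K⟩)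
  · rintro h _ _ _ ⟨j, K⟩
    exact (hasLiftingProperty_pre_iff _ _ _).2 (h K j (.infer_property _))

theorem SSetWeakEquivalences.of_llp {A B : SSet.{u}} {i : A ⟶ B}
    (h : KanRestrictions.{u}.llp i) : SSetWeakEquivalences i :=
  of_rlp_pre i ((KanRestrictions.llp_iff i).1 h)

theorem SSetWeakEquivalences.llp {A B : SSet.{u}} {i : A ⟶ B} [Mono i]
    (h : SSetWeakEquivalences i) : KanRestrictions.{u}.llp i :=
  (KanRestrictions.llp_iff i).2 h.rlp_pre

theorem SSetWeakEquivalences.of_isPushout {A B A' B' : SSet.{u}} {i : A ⟶ B} [Mono i]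
    {f : A ⟶ A'} {g : B ⟶ B'} {i' : A' ⟶ B'} (hi : SSetWeakEquivalences i)
    (sq : IsPushout f i i' g) : SSetWeakEquivalences i' :=
  of_llp (MorphismProperty.of_isPushout sq hi.llp)

end SimplicialHomotopy

section Diagonal

open MonoidalCategory CartesianMonoidalCategory HomotopicalAlgebra SSet SSet.modelCategoryQuillen

/-! ### The diagonal of a levelwise acyclic monomorphism -/

/-- Attaching the image of a map that is injective away from the preimage of a subcomplex. -/
theorem isPushout_preimage {Z W : SSet.{u}} (g : Z ⟶ W) (D : W.Subcomplex)
    (P : Z.Subcomplex) (hP : P = D.preimage g)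
    (hg : ∀ (n : SimplexCategoryᵒᵖ) (x y : Z.obj n), x ∉ P.obj n → y ∉ P.obj n →
      g.app n x = g.app n y → x = y)
    (D' : W.Subcomplex) (hD' : D' = D ⊔ Subcomplex.range g) :
    IsPushout (Subcomplex.lift (X := P.toSSet) (B := D) (P.ι ≫ g)
        (by rintro n _ ⟨x, rfl⟩; subst hP; exact x.2)) P.ι
      (Subcomplex.homOfLE (hD' ▸ le_sup_left : D ≤ D'))
      (Subcomplex.lift g (hD' ▸ le_sup_right)) := by
  subst hP hD'
  refine ⟨⟨rfl⟩, ⟨evaluationJointlyReflectsColimits _ fun n =>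
    (isColimitMapCoconePushoutCoconeEquiv _ _).2 (IsPushout.isColimit ?_)⟩⟩
  refine Types.isPushout_of_isPullback_of_mono' ?_ ?_ ?_
  · rw [Types.isPullback_iff]
    refine ⟨rfl, fun x₁ x₂ h => Subtype.ext h.2, fun x₂ x₃ h => ?_⟩
    have h' : x₂.1 = g.app n x₃ := congrArg Subtype.val h
    exact ⟨⟨x₃, show g.app n x₃ ∈ D.obj n from h' ▸ x₂.2⟩, Subtype.ext h'.symm, rfl⟩
  · rw [Set.eq_univ_iff_forall]
    rintro ⟨x, hx | ⟨z, rfl⟩⟩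
    · exact Or.inl ⟨⟨x, hx⟩, rfl⟩
    · exact Or.inr ⟨z, rfl⟩
  · intro x y hx hy h
    exact hg n x y (fun h => hx ⟨⟨x, h⟩, rfl⟩) (fun h => hy ⟨⟨y, h⟩, rfl⟩) (congrArg Subtype.val h)

instance mono_whiskerRight {A B : SSet.{u}} (i : A ⟶ B) [Mono i] (T : SSet.{u}) :
    Mono (i ▷ T) := by
  rw [NatTrans.mono_iff_mono_app]
  intro n
  rw [mono_iff_injective]
  have : Mono (i.app n) := inferInstance
  rw [mono_iff_injective] at this
  rintro ⟨a, t⟩ ⟨b, t'⟩ h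
  exact Prod.ext (this (Prod.ext_iff.1 h).1) (Prod.ext_iff.1 h).2

/-- The pushout-product of an acyclic inclusion with any inclusion of a subcomplex is acyclic. -/
theorem SSetWeakEquivalences.unionProd {X Y : SSet.{u}} {S : X.Subcomplex}
    (hS : SSetWeakEquivalences S.ι) (T : Y.Subcomplex) :
    SSetWeakEquivalences (S.unionProd T).ι := by
  have h₂ := (hS.whiskerRight T).of_isPushout (Subcomplex.unionProd.isPushout S T).flip
  refine of_comp_left h₂ ?_
  rw [Subcomplex.unionProd.ι₂_ι]
  exact hS.whiskerRight Y

theorem SSetWeakEquivalences.homOfLE_sup {X : SSet.{u}} (S T U V : X.Subcomplex)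
    (sq : Subcomplex.BicartSq U S T V)
    (h : SSetWeakEquivalences (Subcomplex.homOfLE sq.le₁₃)) :
    SSetWeakEquivalences (Subcomplex.homOfLE sq.le₂₄) :=
  h.of_isPushout sq.isPushout

theorem sSetWeakEquivalences_range_ι_iff {X Y : SSet.{u}} (f : X ⟶ Y) [Mono f] :
    SSetWeakEquivalences (Subcomplex.range f).ι ↔ SSetWeakEquivalences f :=
  ⟨fun h => (SSetWeakEquivalences.of_isIso (Subcomplex.toRange f)).comp h,
    fun h => SSetWeakEquivalences.of_comp_left (.of_isIso (Subcomplex.toRange f)) h⟩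

variable {X Y : SimplexCategoryᵒᵖ ⥤ SSet.{u}} (f : X ⟶ Y)

theorem range_app_map {m n : SimplexCategoryᵒᵖ} (θ : m ⟶ n) {k : SimplexCategoryᵒᵖ}
    {y : (Y.obj m).obj k} (hy : y ∈ (Subcomplex.range (f.app m)).obj k) :
    (Y.map θ).app k y ∈ (Subcomplex.range (f.app n)).obj k := by
  obtain ⟨x, rfl⟩ := hy
  exact ⟨(X.map θ).app k x, ConcreteCategory.congr_hom (congr_app (f.naturality θ) k) x⟩

theorem map_app_map_app {m n l : SimplexCategoryᵒᵖ} (θ : m ⟶ n) (θ' : n ⟶ l)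
    {k : SimplexCategoryᵒᵖ} (y : (Y.obj m).obj k) :
    (Y.map θ').app k ((Y.map θ).app k y) = (Y.map (θ ≫ θ')).app k y := by
  rw [Y.map_comp]
  rfl

theorem map_app_id {m : SimplexCategoryᵒᵖ} {θ : m ⟶ m} (h : θ = 𝟙 m)
    {k : SimplexCategoryᵒᵖ} (y : (Y.obj m).obj k) : (Y.map θ).app k y = y := by
  rw [h, Y.map_id]
  rfl

/-- The union of `X_n` and of the images of the degeneracies `s_i : Y_{n-1} ⟶ Y_n` with `i < k`.
For `k = n` it is the relative latching object of `f : X ⟶ Y`. -/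
def partialLatching (n k : ℕ) : (Y.obj (op ⦋n⦌)).Subcomplex :=
  match n with
  | 0 => Subcomplex.range (f.app _)
  | n + 1 => Subcomplex.range (f.app _) ⊔
      ⨆ i : {i : Fin (n + 1) // i.val < k}, Subcomplex.range (Y.map (SimplexCategory.σ i.1).op)

theorem mem_partialLatching_succ {n k : ℕ} {m : SimplexCategoryᵒᵖ}
    {y : (Y.obj (op ⦋n + 1⦌)).obj m} :
    y ∈ (partialLatching f (n + 1) k).obj m ↔ y ∈ (Subcomplex.range (f.app _)).obj m ∨
      ∃ i : Fin (n + 1), i.val < k ∧ ∃ z : (Y.obj (op ⦋n⦌)).obj m,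
        (Y.map (SimplexCategory.σ i).op).app m z = y := by
  simp [partialLatching]

theorem mem_partialLatching_iff {n : ℕ} {m : SimplexCategory}
    {y : (Y.obj (op ⦋n⦌)).obj (op m)} :
    y ∈ (partialLatching f n n).obj (op m) ↔ y ∈ (Subcomplex.range (f.app _)).obj (op m) ∨
      y ∈ SSet.degenerate (Y.flip.obj (op m)) n := by
  obtain _ | n := n
  · simp [partialLatching]
  · rw [mem_partialLatching_succ, SSet.degenerate_eq_iUnion_range_σ, Set.mem_iUnion]
    exact or_congr Iff.rfl ⟨fun ⟨i, _, h⟩ => ⟨i, h⟩, fun ⟨i, h⟩ => ⟨i, i.2, h⟩⟩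

/-- The image of the degeneracy `s_k` meets the part of `Y_{n+1}` built from `X` and the `s_i` with
`i < k` in the image under `s_k` of the analogous part of `Y_n`, by the simplicial identities. -/
theorem partialLatching_inf_range_σ {n : ℕ} (k : Fin (n + 1)) :
    partialLatching f (n + 1) k ⊓ Subcomplex.range (Y.map (SimplexCategory.σ k).op) =
      (partialLatching f n k).image (Y.map (SimplexCategory.σ k).op) := by
  ext m y
  constructor
  · rintro ⟨hy, z, rfl⟩
    refine ⟨z, ?_, rfl⟩
    rw [mem_partialLatching_succ] at hy
    obtain hy | ⟨i, hi, w, hw⟩ := hy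
    · have := range_app_map f (SimplexCategory.δ k.castSucc).op hy
      rw [map_app_map_app, map_app_id (by
        rw [← op_comp, SimplexCategory.δ_comp_σ_self, op_id])] at this
      cases n
      exacts [this, (mem_partialLatching_succ f).2 (Or.inl this)]
    · obtain _ | n := n
      · omega
      rw [mem_partialLatching_succ]
      right
      have hik : i.val < n + 1 := by omega
      refine ⟨⟨i, hik⟩, hi, (Y.map (SimplexCategory.δ k).op).app m w, ?_⟩
      have e := congrArg ((Y.map (SimplexCategory.δ k.succ).op).app m) hw
      rw [map_app_map_app, map_app_map_app, map_app_id (y := z) (by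
        rw [← op_comp, SimplexCategory.δ_comp_σ_succ, op_id])] at e
      rw [← e, map_app_map_app, ← op_comp, ← op_comp]
      have := SimplexCategory.δ_comp_σ_of_gt (i := k) (j := ⟨i, hik⟩) hi
      rw [← this]
      rfl
  · rintro ⟨z, hz, rfl⟩
    refine ⟨?_, z, rfl⟩
    rw [mem_partialLatching_succ]
    obtain _ | n := n
    · exact Or.inl (range_app_map f _ hz)
    · rw [mem_partialLatching_succ] at hz
      obtain hz | ⟨i, hi, w, rfl⟩ := hz
      · exact Or.inl (range_app_map f _ hz)
      · right
        obtain ⟨k, rfl⟩ : ∃ k' : Fin (n + 1), k = k'.succ := ⟨k.pred (by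
          rintro rfl; simp at hi), by simp⟩
        refine ⟨i.castSucc, hi, (Y.map (SimplexCategory.σ k).op).app m w, ?_⟩
        rw [map_app_map_app, map_app_map_app, ← op_comp, ← op_comp,
          SimplexCategory.σ_comp_σ (Nat.le_of_lt_succ hi)]

theorem partialLatching_zero (n : ℕ) : partialLatching f n 0 = Subcomplex.range (f.app _) := by
  ext m y
  cases n
  · rfl
  · simp [mem_partialLatching_succ]

theorem partialLatching_add_one {n : ℕ} (k : Fin (n + 1)) :
    partialLatching f (n + 1) (k + 1) =
      partialLatching f (n + 1) k ⊔ Subcomplex.range (Y.map (SimplexCategory.σ k).op) := by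
  ext m y
  refine (mem_partialLatching_succ f).trans (Iff.trans ?_
    (or_congr (mem_partialLatching_succ f).symm Iff.rfl))
  rw [or_assoc]
  refine or_congr Iff.rfl ?_
  constructor
  · rintro ⟨i, hi, z, hz⟩
    obtain hi | hi := Nat.lt_succ_iff_lt_or_eq.1 hi
    · exact Or.inl ⟨i, hi, z, hz⟩
    · obtain rfl := Fin.ext hi
      exact Or.inr ⟨z, hz⟩
  · rintro (⟨i, hi, z, hz⟩ | ⟨z, hz⟩)
    · exact ⟨i, by omega, z, hz⟩
    · exact ⟨k, by omega, z, hz⟩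

/-- The inclusion of the relative latching object is acyclic: by induction on `n`, the image of one
degeneracy at a time is added to `X_n`, the intersection with what is already there being an
instance of the same construction one level below. -/
theorem sSetWeakEquivalences_partialLatching_ι [∀ n, Mono (f.app n)]
    (hf : ∀ n, SSetWeakEquivalences (f.app n)) (n k : ℕ) :
    SSetWeakEquivalences (partialLatching f n k).ι := by
  induction n generalizing k with
  | zero => exact (sSetWeakEquivalences_range_ι_iff _).2 (hf _)
  | succ n ih =>
    induction k with
    | zero =>
      rw [partialLatching_zero]
      exact (sSetWeakEquivalences_range_ι_iff _).2 (hf _)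
    | succ k ihk =>
      by_cases hk : k < n + 1
      · lift k to Fin (n + 1) using hk
        let σ := Y.map (SimplexCategory.σ k).op
        have hσ : σ ≫ Y.map (SimplexCategory.δ k.castSucc).op = 𝟙 _ := by
          rw [← Y.map_comp, ← op_comp, SimplexCategory.δ_comp_σ_self, op_id, Y.map_id]
        have : Mono σ := mono_of_mono_fac hσ
        let sq : Subcomplex.BicartSq ((partialLatching f n k).image σ)
          (partialLatching f (n + 1) k) (Subcomplex.range σ) (partialLatching f (n + 1) (k + 1)) :=
          ⟨(partialLatching_add_one f k).symm, partialLatching_inf_range_σ f k⟩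
        have h : SSetWeakEquivalences (Subcomplex.homOfLE sq.le₁₃) := by
          let l := (partialLatching f n k).toImage σ
          have : Mono (l ≫ Subcomplex.ι _) := by
            rw [Subcomplex.toImage_ι]
            infer_instance
          have : Mono l := mono_of_mono _ (Subcomplex.ι _)
          have : IsIso l := isIso_of_mono_of_epi l
          exact SSetWeakEquivalences.of_comp_left (.of_isIso l)
            ((ih k).comp (.of_isIso (Subcomplex.toRange σ)))
        exact SSetWeakEquivalences.of_comp_left (.homOfLE_sup _ _ _ _ sq h)
          (g := (partialLatching f (n + 1) (k + 1)).ι) ihk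
      · have : partialLatching f (n + 1) (k + 1) = partialLatching f (n + 1) k := by
          ext m y
          rw [mem_partialLatching_succ, mem_partialLatching_succ]
          refine or_congr Iff.rfl (exists_congr fun i => and_congr_left fun _ => ?_)
          have := i.2
          omega
        rwa [this]

/-- The map `Y_n ⊗ Δ[n] ⟶ diag Y` sending `(y, t)` to the horizontal restriction of `y` along
`t`. -/
def diagonalCell (Y : SimplexCategoryᵒᵖ ⥤ SSet.{u}) (n : ℕ) :
    Y.obj (op ⦋n⦌) ⊗ Δ[n] ⟶ diagonal.obj Y where
  app m := ↾fun y => (Y.map (stdSimplex.objEquiv y.2).op).app m y.1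
  naturality m m' θ := by
    ext ⟨y, t⟩
    change (Y.map _).app m' ((Y.obj _).map θ y) =
      (Y.obj m').map θ ((Y.map θ).app m ((Y.map (stdSimplex.objEquiv t).op).app m y))
    rw [map_app_map_app, NatTrans.naturality_apply]
    rfl

/-- The `d`-th stage of the skeletal filtration of `diag Y` relative to `diag X`. -/
def diagonalFiltration (d : ℕ) : (diagonal.obj Y).Subcomplex :=
  Subcomplex.range (diagonal.map f) ⊔ ⨆ k : Fin d, Subcomplex.range (diagonalCell Y k)

theorem mem_diagonalFiltration {d : ℕ} {m : SimplexCategory} {y : (Y.obj (op m)).obj (op m)} :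
    y ∈ (diagonalFiltration f d).obj (op m) ↔
      y ∈ (Subcomplex.range (f.app (op m))).obj (op m) ∨
        ∃ k, k < d ∧ ∃ (t : m ⟶ ⦋k⦌) (z : (Y.obj (op ⦋k⦌)).obj (op m)),
          (Y.map t.op).app (op m) z = y := by
  have : y ∈ (diagonalFiltration f d).obj (op m) ↔
      y ∈ (Subcomplex.range (diagonal.map f)).obj (op m) ∨
        ∃ k : Fin d, ∃ z, (diagonalCell Y k).app (op m) z = y := by
    simp [diagonalFiltration]
    exact or_congr Iff.rfl Set.mem_iUnion
  rw [this]
  refine or_congr Iff.rfl ⟨?_, ?_⟩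
  · rintro ⟨k, z, hz⟩
    exact ⟨k, k.2, stdSimplex.objEquiv.{u} z.2, z.1, hz⟩
  · rintro ⟨k, hk, t, z, hz⟩
    refine ⟨⟨k, hk⟩, ⟨z, stdSimplex.objEquiv.{u}.symm t⟩, ?_⟩
    rw [← hz]
    change (Y.map (stdSimplex.objEquiv.{u} (stdSimplex.objEquiv.{u}.symm t)).op).app (op m) z = _
    rw [Equiv.apply_symm_apply]

theorem diagonalFiltration_succ (d : ℕ) : diagonalFiltration f (d + 1) =
    diagonalFiltration f d ⊔ Subcomplex.range (diagonalCell Y d) := by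
  simp only [diagonalFiltration, sup_assoc]
  congr 1
  apply le_antisymm
  · refine iSup_le fun k => ?_
    induction k using Fin.lastCases with
    | last => exact le_sup_right
    | cast k =>
      exact le_sup_of_le_left (le_iSup (fun k : Fin d => Subcomplex.range (diagonalCell Y k)) k)
  · refine sup_le (iSup_le fun k => ?_) ?_
    · exact le_iSup (fun k : Fin (d + 1) => Subcomplex.range (diagonalCell Y k)) k.castSucc
    · exact le_iSup (fun k : Fin (d + 1) => Subcomplex.range (diagonalCell Y k)) (Fin.last d)

/-- The simplices of `Y_d ⊗ Δ[d]` outside of the pushout-product of the relative latching object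
with the boundary consist of a horizontally nondegenerate simplex that is not in `X_d` and a
surjection. -/
theorem notMem_unionProd {d : ℕ} {m : SimplexCategory} {y : (Y.obj (op ⦋d⦌)).obj (op m)}
    {t : (Δ[d] : SSet.{u}).obj (op m)}
    (h : (⟨y, t⟩ : (Y.obj (op ⦋d⦌)).obj (op m) × _) ∉
      (Subcomplex.unionProd (partialLatching f d d) ∂Δ[d]).obj (op m)) :
    y ∉ (Subcomplex.range (f.app _)).obj (op m) ∧
      y ∈ SSet.nonDegenerate (Y.flip.obj (op m)) d ∧ Epi (stdSimplex.objEquiv t) := by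
  have h' := (Subcomplex.mem_unionProd_iff _ _ _).not.1 h
  rw [not_or] at h'
  have h₂ := (mem_partialLatching_iff f).not.1 h'.2
  rw [not_or] at h₂
  refine ⟨h₂.1, h₂.2, ?_⟩
  rw [SimplexCategory.epi_iff_surjective]
  exact not_not.1 h'.1

/-- As `t` has a section, `y` is a restriction of its degeneracy along `t`. -/
theorem mem_range_of_epi {m n : SimplexCategory} (t : m ⟶ n) [Epi t] {k : SimplexCategoryᵒᵖ}
    {y : (Y.obj (op n)).obj k}
    (h : (Y.map t.op).app k y ∈ (Subcomplex.range (f.app (op m))).obj k) :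
    y ∈ (Subcomplex.range (f.app (op n))).obj k := by
  have := isSplitEpi_of_epi t
  have h' := range_app_map f (section_ t).op h
  rwa [map_app_map_app, map_app_id (y := y) (by rw [← op_comp, IsSplitEpi.id, op_id])] at h'

/-- The part of `Y_d ⊗ Δ[d]` that lies in the previous stage of the filtration. -/
theorem preimage_diagonalFiltration (d : ℕ) :
    Subcomplex.unionProd (partialLatching f d d) ∂Δ[d] =
      (diagonalFiltration f d).preimage (diagonalCell Y d) := by
  ext ⟨m⟩ ⟨y, t⟩
  constructor
  · intro h
    refine (mem_diagonalFiltration f).2 ?_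
    obtain h | h := (Subcomplex.mem_unionProd_iff _ _ _).1 h
    · obtain _ | d := d
      · exact absurd (fun x => ⟨0, Subsingleton.elim (α := Fin 1) _ _⟩) h
      · obtain ⟨i, q, hq⟩ := SimplexCategory.eq_comp_δ_of_not_surjective
          (stdSimplex.objEquiv t) h
        refine Or.inr ⟨d, d.lt_succ_self, q, (Y.map (SimplexCategory.δ i).op).app _ y, ?_⟩
        rw [map_app_map_app, ← op_comp, ← hq]
        rfl
    · obtain h | ⟨k, hk, g, z, hz⟩ := (mem_partialLatching_iff f).1 h
      · exact Or.inl (range_app_map f _ h)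
      · refine Or.inr ⟨k, hk, stdSimplex.objEquiv t ≫ g, z, ?_⟩
        have hz : (Y.map g.op).app _ z = y := hz
        change _ = (Y.map (stdSimplex.objEquiv t).op).app _ y
        rw [← hz, map_app_map_app, ← op_comp]
  · intro h
    by_contra hn
    obtain ⟨h₁, h₂, h₃⟩ := notMem_unionProd f hn
    obtain h | ⟨k, hk, r, z, hz⟩ := (mem_diagonalFiltration f).1 h
    · exact h₁ (mem_range_of_epi f _ h)
    · have := isSplitEpi_of_epi (stdSimplex.objEquiv t)
      refine h₂ ⟨k, hk, section_ (stdSimplex.objEquiv t) ≫ r, z, ?_⟩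
      have hz : (Y.map r.op).app _ z = (Y.map (stdSimplex.objEquiv t).op).app _ y := hz
      have e := congrArg ((Y.map (section_ (stdSimplex.objEquiv t)).op).app _) hz
      rw [map_app_map_app, map_app_map_app, map_app_id (y := y) (by
        rw [← op_comp, IsSplitEpi.id, op_id])] at e
      exact e

/-- Uniqueness in the Eilenberg–Zilber lemma: a simplex is the degeneracy of a unique nondegenerate
simplex, along a unique surjection. -/
theorem diagonalCell_injective (d : ℕ) (m : SimplexCategoryᵒᵖ)
    (x y : (Y.obj (op ⦋d⦌) ⊗ Δ[d]).obj m)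
    (hx : x ∉ (Subcomplex.unionProd (partialLatching f d d) ∂Δ[d]).obj m)
    (hy : y ∉ (Subcomplex.unionProd (partialLatching f d d) ∂Δ[d]).obj m)
    (h : (diagonalCell Y d).app m x = (diagonalCell Y d).app m y) : x = y := by
  obtain ⟨x, t⟩ := x
  obtain ⟨y, t'⟩ := y
  obtain ⟨_, h₂, h₃⟩ := notMem_unionProd f hx
  obtain ⟨_, h₂', h₃'⟩ := notMem_unionProd f hy
  have e₁ := SSet.unique_nonDegenerate_simplex (Y.flip.obj m) _ (stdSimplex.objEquiv t) ⟨x, h₂⟩ rfl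
    (stdSimplex.objEquiv t') ⟨y, h₂'⟩ h
  have e₂ := SSet.unique_nonDegenerate_map (Y.flip.obj m) _ (stdSimplex.objEquiv t) ⟨x, h₂⟩ rfl
    (stdSimplex.objEquiv t') ⟨y, h₂'⟩ h
  exact Prod.ext (congrArg Subtype.val e₁) (stdSimplex.objEquiv.injective e₂)

theorem diagonalFiltration_monotone : Monotone (diagonalFiltration f) :=
  monotone_nat_of_le_succ fun d => (diagonalFiltration_succ f d).ge.trans' le_sup_left

theorem iSup_diagonalFiltration : ⨆ d, diagonalFiltration f d = ⊤ := by
  ext ⟨m⟩ y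
  refine iff_of_true ?_ trivial
  rw [Subfunctor.iSup_obj, Set.mem_iUnion]
  exact ⟨m.len + 1, (mem_diagonalFiltration f).2 (Or.inr ⟨m.len, m.len.lt_succ_self, 𝟙 _, y,
    map_app_id rfl y⟩)⟩

/-- The diagonal of a levelwise acyclic monomorphism of simplicial objects is a weak equivalence:
each step of the skeletal filtration of `diag Y` relative to `diag X` is a pushout of the
pushout-product of a relative latching inclusion with `∂Δ[d] ⟶ Δ[d]`. -/
theorem sSetWeakEquivalences_diagonal_map [∀ n, Mono (f.app n)]
    (hf : ∀ n, SSetWeakEquivalences (f.app n)) : SSetWeakEquivalences (diagonal.map f) := by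
  have : Mono (diagonal.map f) := by
    rw [NatTrans.mono_iff_mono_app]
    intro n
    exact inferInstanceAs (Mono ((f.app n).app n))
  rw [← sSetWeakEquivalences_range_ι_iff]
  have step (d : ℕ) : KanRestrictions.{u}.llp
      (Subcomplex.homOfLE (diagonalFiltration_monotone f d.le_succ)) :=
    MorphismProperty.of_isPushout (isPushout_preimage (diagonalCell Y d) (diagonalFiltration f d) _
      (preimage_diagonalFiltration f d) (diagonalCell_injective f d) _
      (diagonalFiltration_succ f d))
      ((sSetWeakEquivalences_partialLatching_ι f hf d d).unionProd _).llp
  have h₀ : diagonalFiltration f 0 = Subcomplex.range (diagonal.map f) := by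
    simp [diagonalFiltration]
  let F : TransfiniteCompositionOfShape ℕ (Subcomplex.range (diagonal.map f)).ι :=
    { F := (diagonalFiltration_monotone f).functor ⋙ Subcomplex.toSSetFunctor
      isoBot := Subcomplex.eqToIso h₀
      incl.app _ := Subcomplex.ι _
      isColimit := IsColimit.ofIsoColimit (isColimitOfPreserves (Subcomplex.toSSetFunctor)
        ((CompleteLattice.colimitCocone ((diagonalFiltration_monotone f).functor)).isColimit))
          (Cocone.ext (Subcomplex.eqToIso (iSup_diagonalFiltration f) ≪≫
            Subcomplex.topIso (diagonal.obj Y))) }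
  have hF : KanRestrictions.{u}.llp.TransfiniteCompositionOfShape ℕ
      (Subcomplex.range (diagonal.map f)).ι :=
    { toTransfiniteCompositionOfShape := F
      map_mem := fun d _ => step d }
  exact .of_llp (MorphismProperty.transfiniteCompositionsOfShape_le _ _ _ ⟨hF⟩)

end Diagonal


section Nerve

open MonoidalCategory CartesianMonoidalCategory SSet

/-! ### Nerves of equivalences -/

variable {C C' : Type u} [SmallCategory C] [SmallCategory C']

/-- A natural transformation induces a homotopy between maps of nerves. -/
def nerveHomotopy {F G : C ⥤ C'} (α : F ⟶ G) : nerve C ⊗ Δ[1] ⟶ nerve C' where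
  app n := ↾fun (x : (nerve C).obj n × (Δ[1] : SSet.{u}).obj n) =>
    (Functor.prod' x.1 (stdSimplex.asOrderHom x.2).monotone.functor ⋙
      Functor.uncurry.obj (ComposableArrows.mk₁ α).flip : Fin (n.unop.len + 1) ⥤ C')
  naturality _ _ _ := rfl

theorem homotopic_nerveMap {F G : C ⥤ C'} (α : F ⟶ G) :
    Homotopic (nerveMap F) (nerveMap G) := by
  have key (a : Fin 2) (g : a ⟶ a) (c : C) : ((ComposableArrows.mk₁ α).map g).app c = 𝟙 _ := by
    obtain rfl : g = 𝟙 a := Subsingleton.elim _ _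
    exact congrArg (fun (t : (ComposableArrows.mk₁ α).obj a ⟶ _) => NatTrans.app t c)
      (CategoryTheory.Functor.map_id _ a)
  refine homotopic_iff.2 ⟨nerveHomotopy α, ?_, ?_⟩
  · ext n x
    refine CategoryTheory.Functor.ext (fun _ => rfl) fun i j f => ?_
    refine Eq.trans ?_ ((Category.id_comp _).trans (Category.comp_id _)).symm
    exact (congrArg (F.map (x.map f) ≫ ·) (key 0 (𝟙 _) _)).trans (Category.comp_id _)
  · ext n x
    refine CategoryTheory.Functor.ext (fun _ => rfl) fun i j f => ?_
    refine Eq.trans ?_ ((Category.id_comp _).trans (Category.comp_id _)).symm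
    exact (congrArg (G.map (x.map f) ≫ ·) (key 1 (𝟙 _) _)).trans (Category.comp_id _)

theorem sSetWeakEquivalences_nerveMap (F : C ⥤ C') [F.IsEquivalence] :
    SSetWeakEquivalences (nerveMap F) :=
  .of_homotopyEquiv (nerveMap F.inv)
    (homotopic_nerveMap F.asEquivalence.unitIso.inv)
    (homotopic_nerveMap F.asEquivalence.counitIso.hom)

/-- The nerve of an injective-on-objects faithful functor is a monomorphism. -/
theorem mono_nerveMap (F : C ⥤ C') [F.Faithful] (hF : Function.Injective F.obj) :
    Mono (nerveMap F) := by
  rw [NatTrans.mono_iff_mono_app]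
  intro n
  rw [mono_iff_injective]
  intro x y h
  have h : (x : Fin _ ⥤ C) ⋙ F = (y : Fin _ ⥤ C) ⋙ F := h
  refine CategoryTheory.Functor.ext (fun i => hF (Functor.congr_obj h i)) fun i j f => ?_
  apply F.map_injective
  have := Functor.congr_hom h f
  rw [F.map_comp, F.map_comp, eqToHom_map, eqToHom_map]
  exact this

end Nerve


/-! ### Mates and equivalences of categories -/

section mate
variable {A B A' B' A'' B'' : Type u} [SmallCategory A] [SmallCategory B] [SmallCategory A']
    [SmallCategory B'] [SmallCategory A''] [SmallCategory B''] {L : A ⥤ B} {R : B ⥤ A}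
    {L' : A' ⥤ B'} {R' : B' ⥤ A'} {L'' : A'' ⥤ B''} {R'' : B'' ⥤ A''}
    (adj : L ⊣ R) (adj' : L' ⊣ R') (adj'' : L'' ⊣ R'') {G : A ⥤ A'} {H : B ⥤ B'}
    {G' : A' ⥤ A''} {H' : B' ⥤ B''}

/-- Compatibility of mates with vertical pasting of squares; the 2-cell `γ` is the pasting of `β`
and `β'`, given by its components so that it need not be a composite of associators. -/
theorem mate_comp_app (β : R ⋙ G ⟶ H ⋙ R') (β' : R' ⋙ G' ⟶ H' ⋙ R'')
    (γ : R ⋙ G ⋙ G' ⟶ (H ⋙ H') ⋙ R'')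
    (hγ : ∀ b, γ.app b = G'.map (β.app b) ≫ β'.app (H.obj b)) (a : A) :
    (mate adj adj'' γ).app a =
      (mate adj' adj'' β').app (G.obj a) ≫ H'.map ((mate adj adj' β).app a) := by
  have h := mateEquiv_vcomp adj adj' adj'' ((mateEquiv adj adj').symm (TwoSquare.mk R H G R' β))
    ((mateEquiv adj' adj'').symm (TwoSquare.mk R' H' G' R'' β'))
  rw [Equiv.apply_symm_apply, Equiv.apply_symm_apply, ← Equiv.eq_symm_apply] at h
  have h' := congrArg (fun α => α.natTrans.app a) h
  have e : TwoSquare.mk R (H ⋙ H') (G ⋙ G') R'' γ =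
      TwoSquare.vComp (TwoSquare.mk R H G R' β) (TwoSquare.mk R' H' G' R'' β') := by
    ext b
    simp [TwoSquare.vComp, hγ]
  unfold mate
  rw [e]
  refine h'.symm.trans ?_
  simp [TwoSquare.hComp]

/-- Compatibility of mates with changes of the horizontal functors. -/
theorem mate_app_of_iso {G₁ : A ⥤ A'} {H₁ : B ⥤ B'} (g : G ⟶ G₁) (h : H ⟶ H₁)
    (γ : R ⋙ G ⟶ H ⋙ R') (γ₁ : R ⋙ G₁ ⟶ H₁ ⋙ R')
    (e : ∀ b, γ.app b ≫ R'.map (h.app b) = g.app (R.obj b) ≫ γ₁.app b) (a : A) :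
    (mate adj adj' γ).app a ≫ h.app (L.obj a) = L'.map (g.app a) ≫ (mate adj adj' γ₁).app a := by
  have e' := congrArg L'.map (e (L.obj a))
  have n := congrArg L'.map (g.naturality (adj.unit.app a))
  simp only [Functor.map_comp, Functor.comp_obj, Functor.id_obj] at e' n
  rw [mate_app, mate_app, ← reassoc_of% n, ← reassoc_of% e', Category.assoc, Category.assoc]
  congr 2
  exact (adj'.counit.naturality (h.app (L.obj a))).symm

/-- The mate of an isomorphism along equivalences `G` and `H` is an isomorphism: after applying
`Hom(-, H b)` it becomes the composite of the bijections given by the adjunctions, `G` and `H`. -/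
theorem isIso_mate_of_isEquivalence [G.IsEquivalence] [H.IsEquivalence] (β : R ⋙ G ⟶ H ⋙ R')
    [IsIso β] : IsIso (mate adj adj' β) := by
  rw [NatTrans.isIso_iff_isIso_app]
  intro a
  rw [isIso_iff_coyoneda_map_bijective]
  have key (b : B) : Function.Bijective
      (fun x : H.obj (L.obj a) ⟶ H.obj b => (mate adj adj' β).app a ≫ x) := by
    have hH : Function.Bijective (fun x : L.obj a ⟶ b => H.map x) :=
      ⟨H.map_injective, H.map_surjective⟩
    rw [← Function.Bijective.of_comp_iff _ hH]
    rw [← Function.Bijective.of_comp_iff' (adj'.homEquiv _ _).bijective]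
    have hG : Function.Bijective (fun x : a ⟶ R.obj b => G.map x ≫ β.app b) :=
      (Iso.homToEquiv (asIso (β.app b))).bijective.comp ⟨G.map_injective, G.map_surjective⟩
    refine Eq.mp (congrArg Function.Bijective (funext fun x => ?_))
      (hG.comp (adj.homEquiv a b).bijective)
    symm
    have nat := β.naturality x
    simp only [Functor.comp_map, Functor.comp_obj] at nat
    have hm : (adj'.homEquiv _ _) ((mate adj adj' β).app a) =
        G.map (adj.unit.app a) ≫ β.app (L.obj a) := by
      rw [← Equiv.eq_symm_apply, mate_app, Adjunction.homEquiv_counit, Functor.map_comp_assoc]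
      rfl
    simp only [Function.comp_apply]
    rw [adj'.homEquiv_naturality_right, hm, Adjunction.homEquiv_unit, Functor.map_comp,
      Category.assoc, Category.assoc, nat]
  intro T
  have e := H.objObjPreimageIso T
  have := ((Iso.homToEquiv e).bijective.comp (key (H.objPreimage T))).comp
    (Iso.homToEquiv e.symm).bijective
  refine Eq.mp (congrArg Function.Bijective (funext fun x => ?_)) this
  simp

end mate

section
variable {C C' : Type u} [SmallCategory C] [SmallCategory C'] (F : C ⥤ C')

/-- An equivalence preserves and reflects zero objects. -/
theorem isZero_obj_iff [F.IsEquivalence] {X : C} : IsZero (F.obj X) ↔ IsZero X := by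
  have key (Y Y' : C) : Nonempty (Unique (F.obj Y ⟶ F.obj Y')) ↔ Nonempty (Unique (Y ⟶ Y')) :=
    have e := (Functor.FullyFaithful.ofFullyFaithful F).homEquiv (X := Y) (Y := Y')
    ⟨fun ⟨_⟩ => ⟨e.unique⟩, fun ⟨_⟩ => ⟨e.symm.unique⟩⟩
  refine ⟨fun h => ⟨fun Y => (key _ _).1 (h.unique_to _), fun Y => (key _ _).1 (h.unique_from _)⟩,
    fun h => ⟨fun Y => ?_, fun Y => ?_⟩⟩
  · obtain ⟨_⟩ := (key _ _).2 (h.unique_to (F.objPreimage Y))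
    exact ⟨(Iso.homToEquiv (F.objObjPreimageIso Y).symm).unique⟩
  · obtain ⟨_⟩ := (key _ _).2 (h.unique_from (F.objPreimage Y))
    exact ⟨(Iso.homFromEquiv (F.objObjPreimageIso Y).symm).unique⟩

end


/-! ### Transport along pointwise equivalences -/

namespace Prederivator
variable {𝒟 : DiagramShapes.{u}} {D E F : Prederivator 𝒟}

theorem Mor.square_naturality (φ : Mor D E) {X Y : 𝒟.Shape} {f g : X.cat ⥤ Y.cat} (α : f ⟶ g)
    (b : D.on Y) : (φ.on X).map ((D.pull₂ α).app b) ≫ (φ.square g).hom.app b =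
      (φ.square f).hom.app b ≫ (E.pull₂ α).app ((φ.on Y).obj b) := by
  have := congrArg (fun t => t.toNatTrans.app b) (φ.naturality_naturality
    (Bicategory.Opposite.op2 (InducedBicategory.mkHom₂ (NatTrans.toCatHom₂ α))))
  exact this

theorem Mor.square_comp (φ : Mor D E) {X Y Z : 𝒟.Shape} (f : X.cat ⥤ Y.cat) (g : Y.cat ⥤ Z.cat)
    (b : D.on Z) : (φ.square (f ⋙ g)).hom.app b ≫
      (eqToHom (E.pull_comp f g)).app ((φ.on Z).obj b) =
      (φ.on X).map ((eqToHom (D.pull_comp f g)).app b) ≫ (φ.square f).hom.app ((D.pull g).obj b) ≫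
        (E.pull f).map ((φ.square g).hom.app b) := by
  have := congrArg (fun t => t.toNatTrans.app b) (φ.naturality_comp (cell g).op (cell f).op)
  simp [StrictPseudofunctor.mapComp_eq_eqToIso] at this
  rw [eqToHom_app, eqToHom_app, eqToHom_map]
  exact this

open DiagramShapes in
/-- Compatibility of the structure isomorphisms of `φ` with the comma squares. -/
theorem Mor.square_commaSquare (φ : Mor D E) {X Y : 𝒟.Shape} (f : X.cat ⥤ Y.cat) (y : Y.cat)
    (b : D.on Y) : (φ.on (Shape.comma f y)).map ((D.commaSquare f y).app b) ≫
      (φ.square (Shape.comma f y).toPt).hom.app ((D.pull (Shape.pt y)).obj b) ≫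
        (E.pull (Shape.comma f y).toPt).map ((φ.square (Shape.pt y)).hom.app b) =
    (φ.square (commaSource f y)).hom.app ((D.pull f).obj b) ≫
      (E.pull (commaSource f y)).map ((φ.square f).hom.app b) ≫
        (E.commaSquare f y).app ((φ.on Y).obj b) := by
  have h₁ := φ.square_comp (commaSource f y) f b
  have h₂ := φ.square_comp (Shape.comma f y).toPt (Shape.pt y) b
  have h₃ := φ.square_naturality (commaCell f y) b
  rw [commaSquare, commaSquare]
  simp only [NatTrans.comp_app, Functor.map_comp, Category.assoc]
  rw [← h₂, reassoc_of% h₃]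
  simp only [← Category.assoc]
  congr 2
  rw [eqToHom_app, eqToHom_app, eqToHom_map, comp_eqToHom_iff] at h₁
  rw [eqToHom_app, eqToHom_app, eqToHom_map, h₁]
  simp

/-- Up to isomorphism, `f^*` on `D` is `f^*` on `E` conjugated by equivalences. -/
theorem HasLan.of_isEquivalence (φ : Mor D E) [∀ X, (φ.on X).IsEquivalence]
    (hE : E.HasLan) : D.HasLan := fun X Y f => by
  have := hE f
  have : (φ.on Y ⋙ E.pull f ⋙ (φ.on X).inv).IsRightAdjoint := inferInstance
  exact Functor.isRightAdjoint_of_iso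
    ((Functor.associator _ _ _).symm ≪≫ (Functor.isoWhiskerRight (φ.square f) _).symm ≪≫
      Functor.associator _ _ _ ≪≫ Functor.isoWhiskerLeft _ (φ.on X).asEquivalence.unitIso.symm ≪≫
        Functor.rightUnitor _ : _ ≅ D.pull f)

theorem isCocontinuous_of_isEquivalence (φ : Mor D E) [∀ X, (φ.on X).IsEquivalence]
    (hD : D.HasLan) (hE : E.HasLan) : IsCocontinuous hD hE φ :=
  fun _ _ f => isIso_mate_of_isEquivalence (hD.adj f) (hE.adj f) _

/-- The mate for `φ ≫ ψ` is the pasting of the mates for `φ` and `ψ`, the second of which is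
invertible because `ψ` is a pointwise equivalence. -/
theorem IsCocontinuous.of_comp {hD : D.HasLan} {hE : E.HasLan} {hF : F.HasLan}
    {φ : Mor D E} {ψ : Mor E F} [∀ X, (ψ.on X).IsEquivalence]
    (h : IsCocontinuous hD hF (φ ≫ ψ)) : IsCocontinuous hD hE φ := by
  intro X Y f
  rw [NatTrans.isIso_iff_isIso_app]
  intro a
  have hf := h f
  have hψ := isCocontinuous_of_isEquivalence ψ hE hF f
  have e := mate_comp_app (hD.adj f) (hE.adj f) (hF.adj f) (φ.square f).hom (ψ.square f).hom
    (Mor.square (φ ≫ ψ) f).hom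
    (fun b => (Category.id_comp _).trans (congrArg (_ ≫ ·)
      ((Category.id_comp _).trans (Category.comp_id _)))) a
  have : IsIso ((mate (hD.adj f) (hF.adj f) (Mor.square (φ ≫ ψ) f).hom).app a) :=
    (NatTrans.isIso_iff_isIso_app _).1 hf a
  have : IsIso ((ψ.on Y).map ((mate (hD.adj f) (hE.adj f) (φ.square f).hom).app a)) :=
    @IsIso.of_isIso_fac_left _ _ _ _ _ _ _ _ ((NatTrans.isIso_iff_isIso_app _).1 hψ _) this e.symm
  exact isIso_of_reflects_iso _ (ψ.on Y)

/-- A prederivator that maps to a right derivator by a pointwise equivalence is a right derivator.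
For the base change axiom, the mate of the comma square of `D` is compared with that of `E` by
pasting with the structure isomorphisms of `φ`. -/
theorem IsRightDerivator.of_isEquivalence (φ : Mor D E) [∀ X, (φ.on X).IsEquivalence]
    (hE : E.IsRightDerivator) : D.IsRightDerivator where
  sum X Y := by
    have := hE.sum X Y
    let G : D.on X × D.on Y ⥤ E.on X × E.on Y := (φ.on X).prod (φ.on Y)
    have : G.IsEquivalence :=
      ((φ.on X).asEquivalence.prod (φ.on Y).asEquivalence).isEquivalence_functor
    have i : Functor.prod' (D.pull (X := X) (Y := X.sum Y) (Sum.inl_ X.cat Y.cat))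
        (D.pull (X := Y) (Y := X.sum Y) (Sum.inr_ X.cat Y.cat)) ⋙ G ≅
      φ.on (X.sum Y) ⋙ Functor.prod' (E.pull (X := X) (Y := X.sum Y) (Sum.inl_ X.cat Y.cat))
        (E.pull (X := Y) (Y := X.sum Y) (Sum.inr_ X.cat Y.cat)) :=
      NatIso.ofComponents (fun b => Iso.prod
        ((φ.square (X := X) (Y := X.sum Y) (Sum.inl_ X.cat Y.cat)).app b)
        ((φ.square (X := Y) (Y := X.sum Y) (Sum.inr_ X.cat Y.cat)).app b)) fun g =>
          Prod.ext ((φ.square (X := X) (Y := X.sum Y) (Sum.inl_ X.cat Y.cat)).hom.naturality g)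
            ((φ.square (X := Y) (Y := X.sum Y) (Sum.inr_ X.cat Y.cat)).hom.naturality g)
    have := Functor.isEquivalence_of_iso i.symm
    exact Functor.isEquivalence_of_comp_right _ G
  empty := hE.empty.map fun e => (φ.on 𝒟.empty).asEquivalence.trans e
  conservative X F G g hg := by
    have : IsIso ((φ.on X).map g) := hE.conservative X _ fun x => by
      have := hg x
      rw [← Functor.comp_map, ← NatIso.isIso_map_iff (φ.square (DiagramShapes.Shape.pt x))]
      exact inferInstanceAs (IsIso ((φ.on _).map _))
    exact isIso_of_reflects_iso _ (φ.on X)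
  hasLan := .of_isEquivalence φ hE.hasLan
  baseChange X Y f y := by
    have hD : D.HasLan := .of_isEquivalence φ hE.hasLan
    have hφ := isCocontinuous_of_isEquivalence φ hD hE.hasLan
    rw [NatTrans.isIso_iff_isIso_app]
    intro a
    have hb := hE.baseChange f y
    have hf := hφ f
    have hc := hφ (DiagramShapes.Shape.comma f y).toPt
    let c := DiagramShapes.Shape.comma f y
    let p := DiagramShapes.Shape.pt y
    let j := DiagramShapes.commaSource f y
    have e₁ := mate_comp_app (hD.adj f) (hD.adj c.toPt) (hE.hasLan.adj c.toPt)
      (D.commaSquare f y) (φ.square c.toPt).hom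
      (Functor.whiskerRight (D.commaSquare f y) _ ≫
        Functor.whiskerLeft (D.pull p) (φ.square c.toPt).hom)
      (fun _ => rfl) a
    have e₂ := mate_comp_app (hD.adj f) (hE.hasLan.adj f) (hE.hasLan.adj c.toPt)
      (φ.square f).hom (E.commaSquare f y)
      (Functor.whiskerRight (φ.square f).hom _ ≫ Functor.whiskerLeft (φ.on Y) (E.commaSquare f y))
      (fun _ => rfl) a
    have e₃ := mate_app_of_iso (hD.adj f) (hE.hasLan.adj c.toPt)
      (φ.square j).hom (φ.square p).hom
      (Functor.whiskerRight (D.commaSquare f y) _ ≫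
        Functor.whiskerLeft (D.pull p) (φ.square c.toPt).hom)
      (Functor.whiskerRight (φ.square f).hom _ ≫ Functor.whiskerLeft (φ.on Y) (E.commaSquare f y))
      (fun b => by
        simpa using φ.square_commaSquare f y b) a
    rw [e₁, e₂] at e₃
    have h : IsIso ((φ.on _).map
        ((mate (hD.adj f) (hD.adj c.toPt) (D.commaSquare f y)).app a)) := by
      have h₁ := fun b => Functor.map_isIso (hE.hasLan.lan c.toPt) ((φ.square j).hom.app b)
      have h₂ := (NatTrans.isIso_iff_isIso_app _).1 hb ((φ.on X).obj a)
      have h₃ := (NatTrans.isIso_iff_isIso_app _).1 hf a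
      have h₄ := Functor.map_isIso (E.pull p)
        ((mate (hD.adj f) (hE.hasLan.adj f) (φ.square f).hom).app a)
      have hr := @IsIso.comp_isIso _ _ _ _ _ _ _ (h₁ _) (@IsIso.comp_isIso _ _ _ _ _ _ _ h₂ h₄)
      rw [← e₃] at hr
      exact @IsIso.of_isIso_comp_left _ _ _ _ _ _ _ ((NatTrans.isIso_iff_isIso_app _).1 hc _)
        (@IsIso.of_isIso_comp_right _ _ _ _ _ _ _ _ hr)
    exact isIso_of_reflects_iso _ (φ.on _)

theorem IsPointed.of_isEquivalence (φ : Mor D E) [∀ X, (φ.on X).IsEquivalence]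
    (hE : E.IsPointed) : D.IsPointed where
  hasZero X := by
    have := hE.hasZero X
    have h := isZero_zero (E.on X)
    exact ⟨_, (isZero_obj_iff (φ.on X)).1 (h.of_iso ((φ.on X).objObjPreimageIso _))⟩
  pull_isZero X Y f Z hZ := by
    have := hE.pull_isZero f ((isZero_obj_iff (φ.on Y)).2 hZ)
    exact (isZero_obj_iff (φ.on X)).1 (this.of_iso ((φ.square f).app Z))

end Prederivator


/-! ### The simplicial derivator of strings of isomorphisms -/

namespace IsoStrings
variable (C : Type u) [SmallCategory C]

/-- Evaluation of a string of isomorphisms at `i`. -/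
def eval {n : ℕ} (i : Fin (n + 1)) : IsoStrings C n ⥤ C where
  obj F := F.obj.obj i
  map g := g.hom.app i

/-- The constant strings. -/
def const (n : ℕ) : C ⥤ IsoStrings C n where
  obj c := ⟨(Functor.const _).obj c, fun _ _ _ => inferInstanceAs (IsIso (𝟙 c))⟩
  map g := ObjectProperty.homMk ((Functor.const _).map g)

/-- Restriction of strings along a monotone map. -/
def pull {m n : ℕ} (σ : Fin (m + 1) →o Fin (n + 1)) : IsoStrings C n ⥤ IsoStrings C m where
  obj F := ⟨σ.monotone.functor ⋙ F.obj, fun _ _ _ => F.property _⟩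
  map g := ObjectProperty.homMk (Functor.whiskerLeft _ g.hom)

theorem eqToHom_hom_app {n : ℕ} {F G : IsoStrings C n} (h : F = G) (i : Fin (n + 1)) :
    (eqToHom h).hom.app i = eqToHom (congrArg (fun F : IsoStrings C n => F.obj.obj i) h) := by
  subst h
  rfl

theorem const_comp_map {C C' : Type u} [SmallCategory C] [SmallCategory C'] (G : C ⥤ C') (n : ℕ) :
    G ⋙ const C' n = const C n ⋙ IsoStrings.map G n := by
  have h (c : C) : (G ⋙ const C' n).obj c = (const C n ⋙ IsoStrings.map G n).obj c :=
    ObjectProperty.FullSubcategory.ext (const_comp_eq c G).symm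
  refine CategoryTheory.Functor.ext h fun c d g => ?_
  ext i
  refine Eq.trans ?_ (congrArg₂ (· ≫ G.map g ≫ ·)
    (eqToHom_hom_app C' (h c) i).symm (eqToHom_hom_app C' (h d).symm i).symm)
  exact ((Category.id_comp _).trans (Category.comp_id _)).symm

/-- A string of isomorphisms is isomorphic to the constant string at its first object. -/
noncomputable def evalConstIso (n : ℕ) :
    eval C (0 : Fin (n + 1)) ⋙ const C n ≅ 𝟭 (IsoStrings C n) :=
  NatIso.ofComponents (fun F => ObjectProperty.isoMk _ (NatIso.ofComponents
    (fun i => @asIso _ _ _ _ (F.obj.map (homOfLE (Fin.zero_le i))) (F.property _))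
    fun f => (Category.id_comp _).trans
      ((congrArg F.obj.map (Subsingleton.elim _ _)).trans (F.obj.map_comp _ _))))
    fun {F G} g => by
      ext i
      exact (g.hom.naturality (homOfLE (Fin.zero_le i))).symm

theorem pull_comp_map {C C' : Type u} [SmallCategory C] [SmallCategory C'] (G : C ⥤ C') {m n : ℕ}
    (σ : Fin (m + 1) →o Fin (n + 1)) :
    pull C σ ⋙ IsoStrings.map G m = IsoStrings.map G n ⋙ pull C' σ := rfl

theorem pull_comp {l m n : ℕ} (τ : Fin (l + 1) →o Fin (m + 1)) (σ : Fin (m + 1) →o Fin (n + 1)) :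
    pull C (σ.comp τ) = pull C σ ⋙ pull C τ := rfl

instance (n : ℕ) : (eval C (0 : Fin (n + 1))).IsEquivalence :=
  (CategoryTheory.Equivalence.mk (eval C (0 : Fin (n + 1))) (const C n) (evalConstIso C n).symm
    (Iso.refl _)).isEquivalence_functor

instance (n : ℕ) : (const C n).IsEquivalence :=
  (CategoryTheory.Equivalence.mk (eval C (0 : Fin (n + 1))) (const C n) (evalConstIso C n).symm
    (Iso.refl _)).isEquivalence_inverse

instance {n : ℕ} (i : Fin (n + 1)) : (eval C i).IsEquivalence := by
  have e : const C n ⋙ eval C i = 𝟭 C := rfl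
  have : (const C n ⋙ eval C i).IsEquivalence := by rw [e]; infer_instance
  exact Functor.isEquivalence_of_comp_left (const C n) _

instance {m n : ℕ} (σ : Fin (m + 1) →o Fin (n + 1)) : (pull C σ).IsEquivalence := by
  have e : const C n ⋙ pull C σ = const C m := rfl
  have : (const C n ⋙ pull C σ).IsEquivalence := by rw [e]; infer_instance
  exact Functor.isEquivalence_of_comp_left (const C n) _

end IsoStrings

namespace Prederivator
variable {𝒟 : DiagramShapes.{u}} {D E F : Prederivator 𝒟}

/-- The strict morphism with given components. -/
def Mor.mk (app : ∀ a, D.obj a ⟶ E.obj a)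
    (comm : ∀ ⦃a b⦄ (f : a ⟶ b), D.map f ≫ app b = app a ≫ E.map f)
    (nat : ∀ ⦃a b⦄ {f g : a ⟶ b} (η : f ⟶ g),
      D.map₂ η ▷ app b ≫ eqToHom (comm g) = eqToHom (comm f) ≫ app a ◁ E.map₂ η) :
    Mor D E where
  app := app
  naturality f := eqToIso (comm f)
  naturality_naturality η := nat η
  naturality_id a := by
    simp [Strict.leftUnitor_eqToIso, Strict.rightUnitor_eqToIso, D.mapId_eq_eqToIso,
      E.mapId_eq_eqToIso]
  naturality_comp f g := by
    simp [Strict.associator_eqToIso, StrictPseudofunctor.mapComp_eq_eqToIso]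
    erw [Category.id_comp, eqToHom_trans]

theorem Mor.mk_isStrict (app : ∀ a, D.obj a ⟶ E.obj a) (comm) (nat) :
    IsStrict (Mor.mk app comm nat) := fun _ _ f => ⟨comm f, by rfl⟩

/-- The strict morphism `iso_n D ⟶ D` evaluating strings at `i`. -/
def isoEval (D : Prederivator 𝒟) {n : ℕ} (i : Fin (n + 1)) : Mor (D.iso n) D :=
  Mor.mk (fun a => (IsoStrings.eval (D.obj a) i).toCatHom) (fun _ _ _ => rfl) fun _ _ _ _ _ =>
    (Category.comp_id _).trans (Category.id_comp _).symm

/-- The strict morphism `D ⟶ iso_n D` given by the constant strings. -/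
def isoConst (D : Prederivator 𝒟) (n : ℕ) : Mor D (D.iso n) :=
  Mor.mk (fun a => (IsoStrings.const (D.obj a) n).toCatHom) (fun _ _ f =>
    Cat.ext (IsoStrings.const_comp_map (D.map f).toFunctor n)) fun a b f g η => by
      ext c
      refine ObjectProperty.hom_ext _ (NatTrans.ext (funext fun i => ?_))
      refine Eq.trans (b := (D.map₂ η).toNatTrans.app c ≫ 𝟙 _) ?_
        (Eq.trans (b := 𝟙 _ ≫ (D.map₂ η).toNatTrans.app c) ?_ ?_)
      · refine congrArg ((D.map₂ η).toNatTrans.app c ≫ ·) ?_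
        rw [Cat.eqToHom_app]
        exact IsoStrings.eqToHom_hom_app (D.obj b) _ i
      · exact (Category.comp_id _).trans (Category.id_comp _).symm
      · refine congrArg (· ≫ (D.map₂ η).toNatTrans.app c) ?_
        rw [Cat.eqToHom_app]
        symm
        exact IsoStrings.eqToHom_hom_app (D.obj b) _ i

/-- The strict morphism `iso_n D ⟶ iso_m D` restricting strings along a monotone map. -/
def isoPull (D : Prederivator 𝒟) {m n : ℕ} (σ : Fin (m + 1) →o Fin (n + 1)) :
    Mor (D.iso n) (D.iso m) :=
  Mor.mk (fun a => (IsoStrings.pull (D.obj a) σ).toCatHom) (fun _ _ _ => rfl) fun _ _ _ _ _ =>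
    (Category.comp_id _).trans (Category.id_comp _).symm

theorem isoStrings_map₂_eqToHom {C C' : Cat.{u, u}} {f g : C ⟶ C'} (h : f = g) (n : ℕ) :
    (isoStringsFunctor n).map₂ (eqToHom h) = eqToHom (congrArg (isoStringsFunctor n).map h) := by
  subst h
  rfl

theorem IsStrict.comm {φ : Mor D E} (hφ : IsStrict φ) {a b : 𝒟.Shapeᵒᵖ} (f : a ⟶ b) :
    D.map f ≫ φ.app b = φ.app a ≫ E.map f := (hφ f).choose

theorem IsStrict.nat {φ : Mor D E} (hφ : IsStrict φ) {a b : 𝒟.Shapeᵒᵖ} {f g : a ⟶ b} (η : f ⟶ g) :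
    D.map₂ η ▷ φ.app b ≫ eqToHom (hφ.comm g) = eqToHom (hφ.comm f) ≫ φ.app a ◁ E.map₂ η := by
  have := φ.naturality_naturality η
  rwa [(hφ f).choose_spec, (hφ g).choose_spec] at this

/-- The strict morphism `iso_n φ` induced by a strict morphism. -/
def isoMap {φ : Mor D E} (hφ : IsStrict φ) (n : ℕ) : Mor (D.iso n) (E.iso n) :=
  Mor.mk (fun a => (IsoStrings.map (φ.app a).toFunctor n).toCatHom)
    (fun _ _ f => congrArg (isoStringsFunctor n).map (hφ.comm f)) fun a b f g η => by
      have := congrArg (isoStringsFunctor n).map₂ (hφ.nat η)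
      rw [PrelaxFunctor.map₂_comp, PrelaxFunctor.map₂_comp] at this
      exact (congrArg (_ ≫ ·) (isoStrings_map₂_eqToHom (hφ.comm g) n).symm).trans (this.trans
        (congrArg (· ≫ _) (isoStrings_map₂_eqToHom (hφ.comm f) n)))

theorem isStrict_isoEval (D : Prederivator 𝒟) {n : ℕ} (i : Fin (n + 1)) : IsStrict (D.isoEval i) :=
  Mor.mk_isStrict _ _ _

theorem isStrict_isoConst (D : Prederivator 𝒟) (n : ℕ) : IsStrict (D.isoConst n) :=
  Mor.mk_isStrict _ _ _

theorem isStrict_isoPull (D : Prederivator 𝒟) {m n : ℕ} (σ : Fin (m + 1) →o Fin (n + 1)) :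
    IsStrict (D.isoPull σ) :=
  Mor.mk_isStrict _ _ _

theorem isStrict_isoMap {φ : Mor D E} (hφ : IsStrict φ) (n : ℕ) : IsStrict (isoMap hφ n) :=
  Mor.mk_isStrict _ _ _

end Prederivator


/-! ### The pointed right derivators `iso_n D` -/

/-- The isomorphisms `evalConstIso` are natural in the category, which makes them the components of
a modification. -/
theorem IsoStrings.evalConstIso_naturality {C C' : Cat.{u, u}} (G : C ⟶ C') (n : ℕ)
    (h : (isoStringsFunctor n).map G ≫ (IsoStrings.eval C' (0 : Fin (n + 1)) ⋙
      IsoStrings.const C' n).toCatHom = (IsoStrings.eval C (0 : Fin (n + 1)) ⋙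
      IsoStrings.const C n).toCatHom ≫ (isoStringsFunctor n).map G)
    (h' : (isoStringsFunctor n).map G ≫ 𝟙 _ = 𝟙 _ ≫ (isoStringsFunctor n).map G) :
    (isoStringsFunctor n).map G ◁ (IsoStrings.evalConstIso C' n).hom.toCatHom₂ ≫ eqToHom h' =
      eqToHom h ≫ (IsoStrings.evalConstIso C n).hom.toCatHom₂ ▷ (isoStringsFunctor n).map G := by
  ext (F : IsoStrings C n)
  refine ObjectProperty.hom_ext _ (NatTrans.ext (funext fun i => ?_))
  let g := G.toFunctor.map (F.obj.map (homOfLE (Fin.zero_le i)))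
  refine Eq.trans (b := g ≫ 𝟙 _) ?_ (Eq.trans (b := 𝟙 _ ≫ g) ?_ ?_)
  · refine congrArg (g ≫ ·) ?_
    refine (congrArg (fun t : (_ : IsoStrings C' n) ⟶ _ => t.hom.app i)
      (Cat.eqToHom_app _ _ h' F)).trans ?_
    exact IsoStrings.eqToHom_hom_app C' _ i
  · exact (Category.comp_id _).trans (Category.id_comp _).symm
  · refine congrArg (· ≫ g) ?_
    symm
    refine (congrArg (fun t : (_ : IsoStrings C' n) ⟶ _ => t.hom.app i)
      (Cat.eqToHom_app _ _ h F)).trans ?_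
    exact IsoStrings.eqToHom_hom_app C' _ i

namespace Prederivator
variable {𝒟 : DiagramShapes.{u}} {D E F : Prederivator 𝒟}

instance {n : ℕ} (i : Fin (n + 1)) (X : 𝒟.Shape) : ((D.isoEval i).on X).IsEquivalence :=
  inferInstanceAs (IsoStrings.eval (D.on X) i).IsEquivalence

instance (n : ℕ) (X : 𝒟.Shape) : ((D.isoConst n).on X).IsEquivalence :=
  inferInstanceAs (IsoStrings.const (D.on X) n).IsEquivalence

instance {m n : ℕ} (σ : Fin (m + 1) →o Fin (n + 1)) (X : 𝒟.Shape) :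
    ((D.isoPull σ).on X).IsEquivalence :=
  inferInstanceAs (IsoStrings.pull (D.on X) σ).IsEquivalence

/-- `iso_n φ` is cocontinuous because it is identified with `φ` by the evaluations at `0`. -/
theorem isCocontinuous_isoMap {φ : Mor D E} (hφ : IsStrict φ) (n : ℕ) {hD : D.HasLan}
    {hE : E.HasLan} (hD' : (D.iso n).HasLan) (hE' : (E.iso n).HasLan)
    (h : IsCocontinuous hD hE φ) :
    IsCocontinuous hD' hE' (isoMap hφ n) := by
  have e : isoMap hφ n ≫ E.isoEval (0 : Fin (n + 1)) = D.isoEval (0 : Fin (n + 1)) ≫ φ :=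
    ((isStrict_isoMap hφ n).comp (E.isStrict_isoEval _)).ext ((D.isStrict_isoEval _).comp hφ) rfl
  have h' := (isCocontinuous_of_isEquivalence (D.isoEval (0 : Fin (n + 1))) hD' hD).comp h
  rw [← e] at h'
  exact IsCocontinuous.of_comp h'

theorem isoConst_comp_isoEval (D : Prederivator 𝒟) {n : ℕ} (i : Fin (n + 1)) :
    D.isoConst n ≫ D.isoEval i = 𝟙 D.toPseudofunctor :=
  ((D.isStrict_isoConst n).comp (D.isStrict_isoEval i)).ext (isStrict_id _) rfl

/-- The components of an equivalence of prederivators are equivalences of categories. -/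
theorem IsEquivalence.on {φ : Mor D E} (hφ : IsEquivalence φ) (X : 𝒟.Shape) :
    (φ.on X).IsEquivalence := by
  obtain ⟨ψ, ⟨e₁⟩, ⟨e₂⟩⟩ := hφ
  let i₁ : φ.on X ⋙ ψ.on X ≅ 𝟭 _ :=
    { hom := (e₁.hom.as.app (op X)).toNatTrans
      inv := (e₁.inv.as.app (op X)).toNatTrans
      hom_inv_id := congrArg (fun t => (t.as.app (op X)).toNatTrans) e₁.hom_inv_id
      inv_hom_id := congrArg (fun t => (t.as.app (op X)).toNatTrans) e₁.inv_hom_id }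
  let i₂ : ψ.on X ⋙ φ.on X ≅ 𝟭 _ :=
    { hom := (e₂.hom.as.app (op X)).toNatTrans
      inv := (e₂.inv.as.app (op X)).toNatTrans
      hom_inv_id := congrArg (fun t => (t.as.app (op X)).toNatTrans) e₂.hom_inv_id
      inv_hom_id := congrArg (fun t => (t.as.app (op X)).toNatTrans) e₂.inv_hom_id }
  exact (CategoryTheory.Equivalence.mk _ _ i₁.symm i₂).isEquivalence_functor

/-- `D ⟶ iso_n D` is an equivalence of prederivators: evaluation at `0` is a quasi-inverse. -/
theorem isEquivalence_isoConst (D : Prederivator 𝒟) (n : ℕ) : IsEquivalence (D.isoConst n) := by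
  refine ⟨D.isoEval 0, ⟨eqToIso ?_⟩, ⟨?_⟩⟩
  · exact ((Mor.mk_isStrict _ _ _).comp (Mor.mk_isStrict _ _ _)).ext (isStrict_id _) rfl
  · refine Pseudofunctor.StrongTrans.isoMk
      (fun a => Cat.Hom.isoMk (IsoStrings.evalConstIso (D.obj a) n)) fun {a b} f => ?_
    obtain ⟨h, e⟩ := ((D.isStrict_isoEval (0 : Fin (n + 1))).comp (D.isStrict_isoConst n)) f
    obtain ⟨h', e'⟩ := isStrict_id (D.iso n) f
    have k := IsoStrings.evalConstIso_naturality (D.map f) n h h'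
    exact ((congrArg (fun t =>
      (D.iso n).map f ◁ (Cat.Hom.isoMk (IsoStrings.evalConstIso (D.obj b) n)).hom ≫ t)
        (congrArg Iso.hom e')).trans k).trans (congrArg (fun t =>
          t ≫ (Cat.Hom.isoMk (IsoStrings.evalConstIso (D.obj a) n)).hom ▷ (D.iso n).map f)
            (congrArg Iso.hom e).symm)

end Prederivator

namespace PointedRightDerivator
open Prederivator
variable {𝒟 : DiagramShapes.{u}} (D : PointedRightDerivator 𝒟) {E F : PointedRightDerivator 𝒟}

/-- The pointed right derivator `iso_n D`: evaluation at `0` is a pointwise equivalence to `D`. -/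
def iso (n : ℕ) : PointedRightDerivator 𝒟 where
  toPre := D.toPre.iso n
  isRight := .of_isEquivalence (D.toPre.isoEval 0) D.isRight
  isPointed := .of_isEquivalence (D.toPre.isoEval 0) D.isPointed

/-- Evaluation of strings at `i`, as a morphism of pointed right derivators. -/
def isoEval {n : ℕ} (i : Fin (n + 1)) : D.iso n ⟶ D where
  mor := D.toPre.isoEval i
  isStrict := D.toPre.isStrict_isoEval i
  isCocontinuous := isCocontinuous_of_isEquivalence (D.toPre.isoEval i) _ _

/-- Constant strings, as a morphism of pointed right derivators. -/
def isoConst (n : ℕ) : D ⟶ D.iso n where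
  mor := D.toPre.isoConst n
  isStrict := D.toPre.isStrict_isoConst n
  isCocontinuous := isCocontinuous_of_isEquivalence (D.toPre.isoConst n) _ _

/-- Restriction of strings along a monotone map, as a morphism of pointed right derivators. -/
def isoPull {m n : ℕ} (σ : Fin (m + 1) →o Fin (n + 1)) : D.iso n ⟶ D.iso m where
  mor := D.toPre.isoPull σ
  isStrict := D.toPre.isStrict_isoPull σ
  isCocontinuous := isCocontinuous_of_isEquivalence (D.toPre.isoPull σ) _ _

variable {D}

/-- The structure 2-cells of a strict morphism are determined by its components. -/
theorem Hom.ext_app {φ ψ : D ⟶ E} (h : φ.mor.app = ψ.mor.app) : φ = ψ :=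
  Hom.ext (φ.isStrict.ext ψ.isStrict h)

/-- The morphism `iso_n φ` of pointed right derivators. -/
def isoMap (φ : D ⟶ E) (n : ℕ) : D.iso n ⟶ E.iso n where
  mor := Prederivator.isoMap φ.isStrict n
  isStrict := isStrict_isoMap φ.isStrict n
  isCocontinuous := isCocontinuous_isoMap φ.isStrict n _ _ φ.isCocontinuous

theorem isoConst_comp_isoEval {n : ℕ} (i : Fin (n + 1)) : D.isoConst n ≫ D.isoEval i = 𝟙 D :=
  Hom.ext_app rfl

theorem isoConst_comp_isoPull {m n : ℕ} (σ : Fin (m + 1) →o Fin (n + 1)) :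
    D.isoConst n ≫ D.isoPull σ = D.isoConst m :=
  Hom.ext_app rfl

theorem isoConst_comp_isoMap (φ : D ⟶ E) (n : ℕ) :
    D.isoConst n ≫ isoMap φ n = φ ≫ E.isoConst n :=
  Hom.ext_app (funext fun a => Cat.ext (IsoStrings.const_comp_map (φ.mor.app a).toFunctor n).symm)

theorem isoPull_id (n : ℕ) : D.isoPull (OrderHom.id : Fin (n + 1) →o Fin (n + 1)) = 𝟙 (D.iso n) :=
  Hom.ext_app rfl

theorem isoPull_comp {l m n : ℕ} (τ : Fin (l + 1) →o Fin (m + 1)) (σ : Fin (m + 1) →o Fin (n + 1)) :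
    D.isoPull (σ.comp τ) = D.isoPull σ ≫ D.isoPull τ :=
  Hom.ext_app (funext fun a => Cat.ext (IsoStrings.pull_comp (D.toPre.obj a) τ σ))

theorem isoPull_comp_isoMap (φ : D ⟶ E) {m n : ℕ} (σ : Fin (m + 1) →o Fin (n + 1)) :
    D.isoPull σ ≫ isoMap φ m = isoMap φ n ≫ E.isoPull σ :=
  Hom.ext_app (funext fun a => Cat.ext (IsoStrings.pull_comp_map (φ.mor.app a).toFunctor σ))

theorem isoMap_id (D : PointedRightDerivator 𝒟) (n : ℕ) : isoMap (𝟙 D) n = 𝟙 (D.iso n) :=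
  Hom.ext_app rfl

theorem isoMap_comp (φ : D ⟶ E) (ψ : E ⟶ F) (n : ℕ) : isoMap (φ ≫ ψ) n = isoMap φ n ≫ isoMap ψ n :=
  Hom.ext_app rfl

variable (𝒟) in
/-- The functor sending `D` to the simplicial object `n ↦ iso_n D`. -/
def isoFunctor : PointedRightDerivator 𝒟 ⥤ SimplexCategoryᵒᵖ ⥤ PointedRightDerivator 𝒟 where
  obj D :=
    { obj n := D.iso n.unop.len
      map σ := D.isoPull σ.unop.toOrderHom
      map_id n := isoPull_id n.unop.len
      map_comp σ τ := isoPull_comp τ.unop.toOrderHom σ.unop.toOrderHom }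
  map φ :=
    { app n := isoMap φ n.unop.len
      naturality _ _ σ := isoPull_comp_isoMap φ σ.unop.toOrderHom }
  map_id D := NatTrans.ext (funext fun n => isoMap_id D n.unop.len)
  map_comp φ ψ := NatTrans.ext (funext fun n => isoMap_comp φ ψ n.unop.len)

end PointedRightDerivator

/-! ### Invariance of `K` -/

/-- A functor is determined by its objects and its composite with a faithful functor. -/
theorem functor_eq_of_comp_faithful {J C C' : Type*} [Category* J] [Category* C] [Category* C']
    {F G : J ⥤ C} (H : C ⥤ C') [H.Faithful] (hobj : ∀ X, F.obj X = G.obj X)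
    (h : F ⋙ H = G ⋙ H) : F = G :=
  CategoryTheory.Functor.ext hobj fun i j f => H.map_injective (by
    have := Functor.congr_hom h f
    rw [H.map_comp, H.map_comp, eqToHom_map, eqToHom_map]
    exact this)

section
variable {A B : SimplexCategoryᵒᵖ ⥤ Cat.{u, u}} (Ψ : A ⟶ B)

/-- The category with objects the pairs of an object of `C'` and an object of `C` or `none`, and
with the morphisms of `C'`: up to equivalence it is `C'`. -/
abbrev GraphObj (C C' : Type u) [SmallCategory C'] : Type u :=
  InducedCategory C' (Prod.fst : C' × Option C → C')

/-- The projection to `C'`, which is an equivalence. -/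
abbrev GraphObj.proj (C C' : Type u) [SmallCategory C'] : GraphObj C C' ⥤ C' :=
  inducedFunctor _

theorem GraphObj.functor_ext {J C C' : Type u} [SmallCategory J] [SmallCategory C']
    {F G : J ⥤ GraphObj C C'} (h : F ⋙ GraphObj.proj C C' = G ⋙ GraphObj.proj C C')
    (h' : ∀ x, (F.obj x).2 = (G.obj x).2) : F = G :=
  functor_eq_of_comp_faithful (GraphObj.proj C C')
    (fun x => Prod.ext (Functor.congr_obj h x) (h' x)) h

/-- The simplicial category with `n`-th category `GraphObj A_n B_n`. -/
def graph (A B : SimplexCategoryᵒᵖ ⥤ Cat.{u, u}) : SimplexCategoryᵒᵖ ⥤ Cat.{u, u} where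
  obj n := Cat.of (GraphObj (A.obj n) (B.obj n))
  map σ := Functor.toCatHom
    { obj x := ((B.map σ).toFunctor.obj x.1, x.2.map (A.map σ).toFunctor.obj)
      map g := InducedCategory.homMk ((B.map σ).toFunctor.map g.hom)
      map_id _ := InducedCategory.hom_ext (CategoryTheory.Functor.map_id _ _)
      map_comp _ _ := InducedCategory.hom_ext (CategoryTheory.Functor.map_comp _ _ _) }
  map_id n := Cat.ext (GraphObj.functor_ext (C := A.obj n) (C' := B.obj n)
    (congrArg (fun t : B.obj n ⟶ B.obj n => GraphObj.proj (A.obj n) (B.obj n) ⋙ t.toFunctor)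
      (B.map_id n))
    fun x => (congrArg (fun t : A.obj n ⟶ A.obj n => x.2.map t.toFunctor.obj) (A.map_id n)).trans
      (congrFun Option.map_id x.2))
  map_comp {l _ n} σ τ := Cat.ext (GraphObj.functor_ext (C := A.obj n) (C' := B.obj n)
    (congrArg (fun t : B.obj l ⟶ B.obj n => GraphObj.proj (A.obj l) (B.obj l) ⋙ t.toFunctor)
      (B.map_comp σ τ))
    fun x => (congrArg (fun t : A.obj l ⟶ A.obj n => x.2.map t.toFunctor.obj)
      (A.map_comp σ τ)).trans
        (Option.map_map (A.map τ).toFunctor.obj (A.map σ).toFunctor.obj x.2).symm)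

/-- The levelwise projection `(b, x) ↦ b` of the graph. -/
def graphProj (A B : SimplexCategoryᵒᵖ ⥤ Cat.{u, u}) : graph A B ⟶ B where
  app n := (GraphObj.proj (A.obj n) (B.obj n)).toCatHom
  naturality _ _ _ := rfl

/-- The levelwise section `b ↦ (b, none)` of the projection. -/
def graphSection (A B : SimplexCategoryᵒᵖ ⥤ Cat.{u, u}) : B ⟶ graph A B where
  app _ := Functor.toCatHom
    { obj b := (b, none)
      map g := InducedCategory.homMk g }
  naturality _ _ _ := rfl

/-- The levelwise injective functors `a ↦ (Ψ(a), a)`, which lift `Ψ` along the projection. -/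
def graphIncl : A ⟶ graph A B where
  app n := Functor.toCatHom
    { obj a := ((Ψ.app n).toFunctor.obj a, some a)
      map g := InducedCategory.homMk ((Ψ.app n).toFunctor.map g)
      map_id _ := InducedCategory.hom_ext (CategoryTheory.Functor.map_id _ _)
      map_comp _ _ := InducedCategory.hom_ext (CategoryTheory.Functor.map_comp _ _ _) }
  naturality _ n σ := Cat.ext (GraphObj.functor_ext (C := A.obj n) (C' := B.obj n)
    (congrArg Cat.Hom.toFunctor (Ψ.naturality σ)) fun _ => rfl)

variable {Ψ}

/-- The diagonal of the nerve, as a functor on simplicial categories. -/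
def diagNerve : (SimplexCategoryᵒᵖ ⥤ Cat.{u, u}) ⥤ SSet.{u} :=
  (Functor.whiskeringRight _ _ _).obj nerveFunctor ⋙ diagonal

theorem sSetWeakEquivalences_diagNerve_map_of_injective [∀ n, (Ψ.app n).toFunctor.IsEquivalence]
    (h : ∀ n, Function.Injective (Ψ.app n).toFunctor.obj) :
    SSetWeakEquivalences (diagNerve.map Ψ) := by
  have (n : SimplexCategoryᵒᵖ) : Mono ((Functor.whiskerRight Ψ nerveFunctor).app n) :=
    mono_nerveMap (Ψ.app n).toFunctor (h n)
  exact sSetWeakEquivalences_diagonal_map (Functor.whiskerRight Ψ nerveFunctor) fun n =>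
    sSetWeakEquivalences_nerveMap (Ψ.app n).toFunctor

/-- The levelwise equivalence `Ψ` factors as a levelwise injective equivalence into the graph
followed by a retraction of a levelwise injective equivalence. -/
theorem sSetWeakEquivalences_diagNerve_map (hΨ : ∀ n, (Ψ.app n).toFunctor.IsEquivalence) :
    SSetWeakEquivalences (diagNerve.map Ψ) := by
  have h₀ (n) : ((graphProj A B).app n).toFunctor.IsEquivalence :=
    { faithful := InducedCategory.faithful _
      full := InducedCategory.full _
      essSurj := ⟨fun b => ⟨(b, none), ⟨Iso.refl b⟩⟩⟩ }
  have h₁ (n) : ((graphSection A B).app n).toFunctor.IsEquivalence := by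
    have : (((graphSection A B).app n).toFunctor ⋙
        ((graphProj A B).app n).toFunctor).IsEquivalence :=
      inferInstanceAs (𝟭 (B.obj n)).IsEquivalence
    exact Functor.isEquivalence_of_comp_right _ ((graphProj A B).app n).toFunctor
  have h₂ (n) : ((graphIncl Ψ).app n).toFunctor.IsEquivalence := by
    have : (((graphIncl Ψ).app n).toFunctor ⋙ ((graphProj A B).app n).toFunctor).IsEquivalence :=
      hΨ n
    exact Functor.isEquivalence_of_comp_right _ ((graphProj A B).app n).toFunctor
  have w₁ : SSetWeakEquivalences (diagNerve.map (graphSection A B)) :=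
    sSetWeakEquivalences_diagNerve_map_of_injective fun n b b' h => congrArg Prod.fst h
  have w₂ : SSetWeakEquivalences (diagNerve.map (graphIncl Ψ)) :=
    sSetWeakEquivalences_diagNerve_map_of_injective fun n a a' h =>
      Option.some_injective _ (congrArg Prod.snd h)
  have w₃ : SSetWeakEquivalences (diagNerve.map (graphProj A B)) :=
    w₁.of_comp_left (.of_isIso (𝟙 (diagNerve.obj B)))
  exact w₂.comp w₃

end


namespace PointedRightDerivator
open Prederivator DiagramShapes
variable {𝒟 : DiagramShapes.{u}} {D E : PointedRightDerivator 𝒟}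
  (φ : D ⟶ E) [∀ X, (φ.mor.on X).IsEquivalence]

/-- A cocontinuous pointwise equivalence reflects cocartesian squares. -/
theorem Hom.isCocartesian_of_map {F : D.toPre.on 𝒟.squareShape}
    (hF : E.IsCocartesian ((φ.mor.on 𝒟.squareShape).obj F)) : D.IsCocartesian F := by
  have hm := φ.isCocontinuous (X := 𝒟.cornerShape) (Y := 𝒟.squareShape) cornerIncl
  have e := mateEquiv_counit_symm (D.isRight.hasLan.adj (X := 𝒟.cornerShape) (Y := 𝒟.squareShape)
    cornerIncl) (E.isRight.hasLan.adj (X := 𝒟.cornerShape) (Y := 𝒟.squareShape) cornerIncl)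
    (TwoSquare.mk _ _ _ _ (Mor.square φ.mor (X := 𝒟.cornerShape) (Y := 𝒟.squareShape)
      cornerIncl).hom) F
  have h₁ := (NatTrans.isIso_iff_isIso_app _).1 hm
    ((D.toPre.pull (X := 𝒟.cornerShape) (Y := 𝒟.squareShape) cornerIncl).obj F)
  have h₂ := Functor.map_isIso (E.isRight.hasLan.lan (X := 𝒟.cornerShape) (Y := 𝒟.squareShape)
    cornerIncl) ((Mor.square φ.mor (X := 𝒟.cornerShape) (Y := 𝒟.squareShape) cornerIncl).hom.app F)
  have h₃ := @IsIso.comp_isIso _ _ _ _ _ _ _ h₂ hF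
  have h₄ := e ▸ h₃
  have h₅ := @IsIso.of_isIso_comp_left _ _ _ _ _ _ _ h₁ h₄
  unfold IsCocartesian
  exact isIso_of_reflects_iso _ (φ.mor.on 𝒟.squareShape)

/-- A cocontinuous pointwise equivalence reflects the objects of `S_n`. -/
theorem Hom.sObj_of_map {n : ℕ} (F : D.toPre.on (𝒟.arShape n))
    (hF : E.sObj n ((φ.mor.on (𝒟.arShape n)).obj F)) : D.sObj n F := by
  refine ⟨fun i => ?_, fun i j k hij hjk => ?_⟩
  · have e := congrArg (fun G => G.obj F) (Hom.comm φ (Y := 𝒟.arShape n)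
      (Shape.pt (Ar.mk i i le_rfl)))
    have := hF.1 i
    exact (isZero_obj_iff (φ.mor.on _)).1 (e ▸ this)
  · have e := congrArg (fun G => G.obj F) (Hom.comm φ (X := 𝒟.squareShape) (Y := 𝒟.arShape n)
      (Ar.square i j k hij hjk))
    have := hF.2 i j k hij hjk
    exact Hom.isCocartesian_of_map φ (e ▸ this)

theorem sObj_of_iso {n : ℕ} {F G : D.toPre.on (𝒟.arShape n)} (e : F ≅ G) (hF : D.sObj n F) :
    D.sObj n G := by
  refine ⟨fun i => (hF.1 i).of_iso ((D.toPre.pull (Y := 𝒟.arShape n) _).mapIso e.symm),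
    fun i j k hij hjk => ?_⟩
  have h := hF.2 i j k hij hjk
  unfold IsCocartesian at h ⊢
  exact (NatTrans.isIso_app_iff_of_iso _ ((D.toPre.pull (X := 𝒟.squareShape) (Y := 𝒟.arShape n)
    (Ar.square i j k hij hjk)).mapIso e)).1 h

/-- The functors `S_n D ⟶ S_n E` are essentially surjective since `φ` reflects the objects of `S_n`
and `S_n D` is closed under isomorphisms. -/
theorem Hom.isEquivalence_sMap_app (n : SimplexCategoryᵒᵖ) :
    ((Hom.sMap φ).app n).toFunctor.IsEquivalence := by
  let H := φ.mor.on (𝒟.arShape n.unop.len)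
  exact
    { faithful := ⟨fun {_ _} f g h => ObjectProperty.hom_ext _
        (H.map_injective (congrArg (fun t => t.hom) h))⟩
      full := ⟨fun {_ _} f => ⟨ObjectProperty.homMk (H.preimage f.hom),
        ObjectProperty.hom_ext _ (H.map_preimage f.hom)⟩⟩
      essSurj := ⟨fun F =>
        have h : D.sObj n.unop.len (H.objPreimage F.obj) :=
          Hom.sObj_of_map φ _ (sObj_of_iso (H.objObjPreimageIso F.obj).symm F.property)
        ⟨⟨_, h⟩, ⟨ObjectProperty.isoMk _ (H.objObjPreimageIso F.obj)⟩⟩⟩ }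

theorem sSetWeakEquivalences_derivatorK_map : SSetWeakEquivalences ((derivatorK 𝒟).map φ) := by
  refine sSetWeakEquivalences_diagNerve_map
    (Ψ := Functor.whiskerRight (Hom.sMap φ) coreFunctor) fun n => ?_
  have := Hom.isEquivalence_sMap_app φ n
  exact (((Hom.sMap φ).app n).toFunctor.asEquivalence.core).isEquivalence_functor

end PointedRightDerivator


/-! ### Strings of isomorphisms in `S_n D` -/

/-- Functors to the core of a full subcategory are determined by the underlying functors. -/
theorem functor_core_ext {J : Type*} {C : Type u} [Category* J] [SmallCategory C]
    {P : ObjectProperty C}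
    {F G : J ⥤ Core P.FullSubcategory} (hobj : ∀ i, (F.obj i).of.obj = (G.obj i).of.obj)
    (h : ∀ ⦃i j⦄ (f : i ⟶ j), (F.map f).iso.hom.hom =
      eqToHom (hobj i) ≫ (G.map f).iso.hom.hom ≫ eqToHom (hobj j).symm) : F = G := by
  refine functor_eq_of_comp_faithful (Core.inclusion _ ⋙ P.ι)
    (fun i => congrArg Core.mk (ObjectProperty.FullSubcategory.ext (hobj i)))
    (CategoryTheory.Functor.ext hobj h)

namespace PointedRightDerivator
open Prederivator DiagramShapes
variable {𝒟 : DiagramShapes.{u}} (D : PointedRightDerivator 𝒟)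

instance isEquivalence_isoEval_on {m : ℕ} (i : Fin (m + 1)) (X : 𝒟.Shape) :
    ((D.isoEval i).mor.on X).IsEquivalence :=
  inferInstanceAs (IsoStrings.eval (D.toPre.on X) i).IsEquivalence

/-- A string of isomorphisms in `S_n D`, as an object of `S_n (iso_m D)`. -/
def sIsoObj {m n : ℕ} (G : Fin (m + 1) ⥤ Core (D.sObj n).FullSubcategory) :
    ((D.iso m).sObj n).FullSubcategory where
  obj := ⟨G ⋙ Core.inclusion _ ⋙ (D.sObj n).ι, fun _ _ f =>
    ((D.sObj n).ι.mapIso (G.map f).iso).isIso_hom⟩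
  property := Hom.sObj_of_map (D.isoEval (0 : Fin (m + 1))) _ (G.obj 0).of.property

/-- The map `K(D) ⟶ diag (n ↦ K^{W,ob}(iso_n D))` (before looping) that reads a string of `n`
isomorphisms in `S_n D` as an object of `S_n (iso_n D)`. -/
def stringObjects : (derivatorK 𝒟).obj D ⟶
    diagonal.obj ((isoFunctor 𝒟).obj D ⋙ waldhausenK 𝒟) where
  app _ := ↾fun G => sIsoObj D G
  naturality _ _ _ := rfl

/-- The diagonal string `i ↦ H(i)(i)` of a string of isomorphisms in `S_n (iso_m D)`. -/
noncomputable def diagString {m n : ℕ} (H : Fin (m + 1) ⥤ Core ((D.iso m).sObj n).FullSubcategory) :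
    Fin (m + 1) ⥤ Core (D.sObj n).FullSubcategory where
  obj i := ⟨⟨(H.obj i).of.obj.obj.obj i, Hom.sObj (D.isoEval i) _ (H.obj i).of.property⟩⟩
  map {i j} f := ⟨ObjectProperty.isoMk _
    (((IsoStrings.eval (D.toPre.on (𝒟.arShape n)) i).mapIso
      (((D.iso m).sObj n).ι.mapIso (H.map f).iso)).trans
        (@asIso _ _ _ _ ((H.obj j).of.obj.obj.map f) ((H.obj j).of.obj.property f)))⟩
  map_id i := by
    refine Core.hom_ext (ObjectProperty.hom_ext _ ?_)
    have h₁ := congrArg (fun t : H.obj i ⟶ H.obj i => t.iso.hom.hom.hom.app i) (H.map_id i)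
    have h₂ := (H.obj i).of.obj.obj.map_id i
    exact (congrArg₂ (· ≫ ·) h₁ h₂).trans (Category.id_comp _)
  map_comp {i j k} f g := by
    refine Core.hom_ext (ObjectProperty.hom_ext _ ?_)
    have h₁ := congrArg (fun t : H.obj i ⟶ H.obj k => t.iso.hom.hom.hom.app i) (H.map_comp f g)
    have h₂ := (H.obj k).of.obj.obj.map_comp f g
    have h₃ := (H.map g).iso.hom.hom.hom.naturality f
    refine (congrArg₂ (· ≫ ·) h₁ h₂).trans ?_
    refine (Category.assoc _ _ _).trans (Eq.trans ?_ (Category.assoc _ _ _).symm)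
    refine congrArg ((H.map f).iso.hom.hom.hom.app i ≫ ·) ?_
    refine (Category.assoc _ _ _).symm.trans (Eq.trans ?_ (Category.assoc _ _ _))
    exact congrArg (· ≫ (H.obj k).of.obj.obj.map g) h₃.symm

/-- The map `diag (n ↦ K(iso_n D)) ⟶ K(D)` (before looping) that takes diagonal strings. -/
noncomputable def diagonalString :
    diagonal.obj ((isoFunctor 𝒟).obj D ⋙ derivatorK 𝒟) ⟶ (derivatorK 𝒟).obj D where
  app n := ↾fun H => diagString D H
  naturality m n σ := by
    ext (H : Fin (m.unop.len + 1) ⥤ Core ((D.iso m.unop.len).sObj m.unop.len).FullSubcategory)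
    refine functor_core_ext (P := D.sObj n.unop.len) (fun _ => rfl) fun i j f => ?_
    refine Eq.trans ?_ ((Category.id_comp _).trans (Category.comp_id _)).symm
    let s := σ.unop.toOrderHom
    exact ((D.arPull s).map_comp ((H.map (s.monotone.functor.map f)).iso.hom.hom.hom.app (s i))
      ((H.obj (s j)).of.obj.obj.map (s.monotone.functor.map f))).symm

/-- The object of `S_n (iso_n D)` belonging to a string `G` is sent by `comparison` to the string of
its identities, a double string that is constant in one direction and has diagonal `G`. -/
theorem stringObjects_comp_diagonalString :
    D.stringObjects ≫ diagonal.map (Functor.whiskerLeft ((isoFunctor 𝒟).obj D) (comparison 𝒟)) ≫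
      D.diagonalString = 𝟙 _ := by
  ext n (G : Fin (n.unop.len + 1) ⥤ Core (D.sObj n.unop.len).FullSubcategory)
  refine functor_core_ext (P := D.sObj n.unop.len) (fun _ => rfl) fun i j f => ?_
  refine Eq.trans ?_ ((Category.id_comp _).trans (Category.comp_id _)).symm
  exact Category.id_comp _

end PointedRightDerivator


/-! ### Diagonals along a simplicial object of endofunctors -/

section
variable {𝒞 : Type v} [Category.{w} 𝒞] (I : 𝒞 ⥤ SimplexCategoryᵒᵖ ⥤ 𝒞)

/-- The functor sending `F` to `D ↦ diag (n ↦ F (I_n D))`. -/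
def diagonalAlong : (𝒞 ⥤ SSet.{u}) ⥤ 𝒞 ⥤ SSet.{u} where
  obj F := I ⋙ (Functor.whiskeringRight _ _ _).obj F ⋙ diagonal
  map η := Functor.whiskerLeft I
    (Functor.whiskerRight ((Functor.whiskeringRight _ _ _).map η) diagonal)

variable {I} (c : Functor.const SimplexCategoryᵒᵖ ⟶ I)

/-- The natural map `F(D) ⟶ diag (n ↦ F (I_n D))` induced by a coaugmentation `D ⟶ I_n D`. -/
def toDiagonalAlong : 𝟭 (𝒞 ⥤ SSet.{u}) ⟶ diagonalAlong I where
  app F :=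
    { app D :=
        { app n := (F.map ((c.app D).app n)).app n
          naturality m n σ := by
            have h := (c.app D).naturality σ
            have h₁ : (c.app D).app n = (c.app D).app m ≫ (I.obj D).map σ :=
              (Category.id_comp _).symm.trans h
            have h₂ := congrArg (fun t => NatTrans.app t n)
              ((congrArg F.map h₁).trans (F.map_comp _ _))
            have h₃ := (F.map ((c.app D).app m)).naturality σ
            calc (F.obj D).map σ ≫ (F.map ((c.app D).app n)).app n
                = (F.obj D).map σ ≫ (F.map ((c.app D).app m)).app n ≫
                    (F.map ((I.obj D).map σ)).app n := congrArg _ h₂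
              _ = ((F.obj D).map σ ≫ (F.map ((c.app D).app m)).app n) ≫
                    (F.map ((I.obj D).map σ)).app n := (Category.assoc _ _ _).symm
              _ = ((F.map ((c.app D).app m)).app m ≫ (F.obj ((I.obj D).obj m)).map σ) ≫
                    (F.map ((I.obj D).map σ)).app n := congrArg (· ≫ _) h₃
              _ = _ := (Category.assoc _ _ _).trans
                    (congrArg _ ((F.map ((I.obj D).map σ)).naturality σ)) }
      naturality D E φ := by
        refine NatTrans.ext (funext fun n => ?_)
        have h : φ ≫ (c.app E).app n = (c.app D).app n ≫ (I.map φ).app n :=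
          congrArg (fun t => NatTrans.app t n) (c.naturality φ)
        have e := congrArg (fun t => NatTrans.app t n)
          ((F.map_comp _ _).symm.trans ((congrArg F.map h).trans (F.map_comp _ _)))
        exact e }
  naturality F G η := by
    refine NatTrans.ext (funext fun D => NatTrans.ext (funext fun n => ?_))
    exact congrArg (fun t => t.app n) (η.naturality ((c.app D).app n)).symm

/-- If `F` sends the coaugmentations to weak equivalences and they have retractions, then
`F(D) ⟶ diag (n ↦ F (I_n D))` is a weak equivalence. -/
theorem sSetWeakEquivalences_toDiagonalAlong (F : 𝒞 ⥤ SSet.{u}) (D : 𝒞)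
    [∀ n, IsSplitMono ((c.app D).app n)] (h : ∀ n, SSetWeakEquivalences (F.map ((c.app D).app n))) :
    SSetWeakEquivalences (((toDiagonalAlong c).app F).app D) := by
  let e : F.obj D ≅ diagonal.obj ((Functor.const _).obj D ⋙ F) :=
    NatIso.ofComponents (fun n => Iso.refl _) fun σ =>
      (Category.comp_id _).trans ((congrArg (fun t => NatTrans.app t _ ≫ (F.obj D).map σ)
        (F.map_id D)).symm.trans (Category.id_comp _).symm)
  have (n : SimplexCategoryᵒᵖ) : Mono ((Functor.whiskerRight (c.app D) F).app n) :=
    inferInstanceAs (Mono (F.map ((c.app D).app n)))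
  exact (SSetWeakEquivalences.of_isIso e.hom).comp
    (sSetWeakEquivalences_diagonal_map (Functor.whiskerRight (c.app D) F) h)

end


/-! ### Invariant approximations -/

open PointedRightDerivator

section App
variable {𝒟 : DiagramShapes.{u}} {S : ObjectProperty (PointedRightDerivator 𝒟)}

theorem isHomotopical_app : IsHomotopical (App.weakEquivalences S) where
  id_mem _ _ := isHomotopical_sSetWeakEquivalences.id_mem _
  two_out_of_six _ _ _ _ f g h hfg hgh :=
    have key (D) := isHomotopical_sSetWeakEquivalences.two_out_of_six (f.hom.right.app D)
      (g.hom.right.app D) (h.hom.right.app D) (hfg D) (hgh D)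
    ⟨fun D => (key D).1, fun D => (key D).2.1, fun D => (key D).2.2.1, fun D => (key D).2.2.2⟩

/-- `K` sends equivalences of derivators to weak equivalences. -/
theorem sendsEquivalences_comparisonUnder : SendsEquivalences S (comparisonUnder S).right :=
  fun _ _ φ hφ =>
    have (X : 𝒟.Shape) : (φ.hom.mor.on X).IsEquivalence := hφ.on X
    sSetWeakEquivalences_derivatorK_map φ.hom

variable (hS : ClosedUnderIso S)

/-- The simplicial object `n ↦ iso_n D` of `S`. -/
def isoInS : S.FullSubcategory ⥤ SimplexCategoryᵒᵖ ⥤ S.FullSubcategory where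
  obj D := S.lift ((isoFunctor 𝒟).obj D.obj) fun _ => hS _ D.property rfl
  map φ :=
    { app n := ObjectProperty.homMk (((isoFunctor 𝒟).map φ.hom).app n)
      naturality _ _ σ := ObjectProperty.hom_ext _ (((isoFunctor 𝒟).map φ.hom).naturality σ) }
  map_id D := NatTrans.ext (funext fun n => ObjectProperty.hom_ext _
    (congrArg (fun t => NatTrans.app t n) ((isoFunctor 𝒟).map_id D.obj)))
  map_comp φ ψ := NatTrans.ext (funext fun n => ObjectProperty.hom_ext _
    (congrArg (fun t => NatTrans.app t n) ((isoFunctor 𝒟).map_comp φ.hom ψ.hom)))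

/-- The morphisms `D ⟶ iso_n D` sending an object to the constant string. -/
def constInS : Functor.const SimplexCategoryᵒᵖ ⟶ isoInS hS where
  app D :=
    { app n := ObjectProperty.homMk (D.obj.isoConst n.unop.len)
      naturality _ _ σ := ObjectProperty.hom_ext _ ((Category.id_comp _).trans
        (isoConst_comp_isoPull σ.unop.toOrderHom).symm) }
  naturality _ _ φ := NatTrans.ext (funext fun n => ObjectProperty.hom_ext _
    (isoConst_comp_isoMap φ.hom n.unop.len).symm)

instance (D : S.FullSubcategory) (n : SimplexCategoryᵒᵖ) :
    IsSplitMono (((constInS hS).app D).app n) :=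
  ⟨⟨⟨ObjectProperty.homMk (D.obj.isoEval 0),
    ObjectProperty.hom_ext _ (isoConst_comp_isoEval (0 : Fin (n.unop.len + 1)))⟩⟩⟩

/-- The morphisms `D ⟶ iso_n D` are equivalences of prederivators, and are split by evaluation at
`0`. -/
theorem SendsEquivalences.weakEquivalence_toDiagonalAlong {F : S.FullSubcategory ⥤ SSet.{u}}
    (hF : SendsEquivalences S F) (D : S.FullSubcategory) :
    SSetWeakEquivalences (((toDiagonalAlong (constInS hS)).app F).app D) :=
  sSetWeakEquivalences_toDiagonalAlong (constInS hS) F D fun n =>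
    hF _ (Prederivator.isEquivalence_isoConst D.obj.toPre n.unop.len)

/-- `F` and `diag (n ↦ F (iso_n -))` are naturally weakly equivalent, so that both are invariant. -/
theorem SendsEquivalences.diagonalAlong_obj {F : S.FullSubcategory ⥤ SSet.{u}}
    (hF : SendsEquivalences S F) : SendsEquivalences S ((diagonalAlong (isoInS hS)).obj F) := by
  intro D E φ hφ
  have h := ((toDiagonalAlong (constInS hS)).app F).naturality φ
  refine (hF.weakEquivalence_toDiagonalAlong hS D).of_comp_left (h ▸ ?_)
  exact (hF φ hφ).comp (hF.weakEquivalence_toDiagonalAlong hS E)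

/-- The natural transformation with components `stringObjects`. -/
def stringObjectsInS : (comparisonUnder S).right ⟶
    (diagonalAlong (isoInS hS)).obj (S.ι ⋙ waldhausenK 𝒟) where
  app D := D.obj.stringObjects
  naturality _ _ _ := rfl

theorem diagonalAlong_map_under {A B : App S} (u : A ⟶ B) :
    (diagonalAlong (isoInS hS)).map A.obj.hom ≫ (diagonalAlong (isoInS hS)).map u.hom.right =
      (diagonalAlong (isoInS hS)).map B.obj.hom :=
  ((diagonalAlong (isoInS hS)).map_comp _ _).symm.trans
    (congrArg (diagonalAlong (isoInS hS)).map (Under.w u.hom))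

/-- The approximation `(η, F)` is sent to `diag (n ↦ F (iso_n -))`. Its structure map from
`K^{W,ob}` first sends an object to the constant strings on it and then applies `η`; it is also the
composite of `comparisonToDiagonalApp` with the structure map of `K`, because the object belonging
to the string of identities is a constant string. -/
def diagonalApp : App S ⥤ App S where
  obj A := ⟨Under.mk ((toDiagonalAlong (constInS hS)).app _ ≫
    (diagonalAlong (isoInS hS)).map A.obj.hom), A.property.diagonalAlong_obj hS⟩
  map u := ObjectProperty.homMk (Under.homMk ((diagonalAlong (isoInS hS)).map u.hom.right)
    ((Category.assoc _ _ _).trans (congrArg (_ ≫ ·) (diagonalAlong_map_under hS u))))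
  map_id A := ObjectProperty.hom_ext _ (Under.UnderMorphism.ext
    ((diagonalAlong (isoInS hS)).map_id A.obj.right))
  map_comp u v := ObjectProperty.hom_ext _ (Under.UnderMorphism.ext
    ((diagonalAlong (isoInS hS)).map_comp u.hom.right v.hom.right))

/-- The natural weak equivalence from the identity to `diagonalApp`. -/
def toDiagonalApp : 𝟭 (App S) ⟶ diagonalApp hS where
  app A := ObjectProperty.homMk (Under.homMk ((toDiagonalAlong (constInS hS)).app A.obj.right)
    ((toDiagonalAlong (constInS hS)).naturality A.obj.hom))
  naturality _ _ u := ObjectProperty.hom_ext _ (Under.UnderMorphism.ext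
    ((toDiagonalAlong (constInS hS)).naturality u.hom.right))

/-- The morphism from `K` to every `diag (n ↦ F (iso_n -))`, natural in the approximation `F`. -/
def comparisonToDiagonalApp : (Functor.const (App S)).obj
    ⟨comparisonUnder S, sendsEquivalences_comparisonUnder⟩ ⟶ diagonalApp hS where
  app A := ObjectProperty.homMk (Under.homMk
    (stringObjectsInS hS ≫ (diagonalAlong (isoInS hS)).map A.obj.hom)
    (Category.assoc _ _ _).symm)
  naturality _ _ u := ObjectProperty.hom_ext _ (Under.UnderMorphism.ext
    ((Category.id_comp _).trans ((congrArg (stringObjectsInS hS ≫ ·)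
      (diagonalAlong_map_under hS u)).symm.trans (Category.assoc _ _ _).symm)))

theorem weakEquivalences_toDiagonalApp_app (A : App S) :
    App.weakEquivalences S ((toDiagonalApp hS).app A) := fun D =>
  A.property.weakEquivalence_toDiagonalAlong hS D

theorem isHomotopicalFunctor_diagonalApp :
    IsHomotopicalFunctor (App.weakEquivalences S) (diagonalApp hS) := by
  intro A B u hu D
  have h := congrArg (fun t => t.hom.right.app D) ((toDiagonalApp hS).naturality u)
  refine (weakEquivalences_toDiagonalApp_app hS A D).of_comp_left ?_
  have := (hu D).comp (weakEquivalences_toDiagonalApp_app hS B D)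
  exact Eq.mp (congrArg (fun t => SSetWeakEquivalences t) h) this

/-- At `K` itself, the morphism `comparisonToDiagonalApp` is a section of the map taking diagonal
strings, and so is the weak equivalence `toDiagonalApp`. -/
theorem weakEquivalences_comparisonToDiagonalApp_app : App.weakEquivalences S
    ((comparisonToDiagonalApp hS).app ⟨comparisonUnder S, sendsEquivalences_comparisonUnder⟩) := by
  intro D
  have h := sendsEquivalences_comparisonUnder.weakEquivalence_toDiagonalAlong hS D
  have e₁ : ((toDiagonalAlong (constInS hS)).app (comparisonUnder S).right).app D ≫
      D.obj.diagonalString = 𝟙 ((derivatorK 𝒟).obj D.obj) := by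
    ext n (G : Fin (n.unop.len + 1) ⥤ Core (D.obj.sObj n.unop.len).FullSubcategory)
    refine functor_core_ext (P := D.obj.sObj n.unop.len) (fun _ => rfl) fun i j f => ?_
    refine Eq.trans ?_ ((Category.id_comp _).trans (Category.comp_id _)).symm
    exact Category.comp_id _
  have h₁ : SSetWeakEquivalences D.obj.diagonalString :=
    h.of_comp_left (e₁ ▸ isHomotopical_sSetWeakEquivalences.id_mem _)
  refine h₁.of_comp_right ?_
  have e₂ := (Category.assoc _ _ _).trans D.obj.stringObjects_comp_diagonalString
  exact Eq.mpr (congrArg (fun t => SSetWeakEquivalences t) e₂)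
    (isHomotopical_sSetWeakEquivalences.id_mem _)

end App

end DerivatorK

open DerivatorK
theorem mainTheorem2 {𝒟 : DiagramShapes.{u}} (S : ObjectProperty (PointedRightDerivator 𝒟))
    (hS : ClosedUnderIso S) :
    IsHomotopical (App.weakEquivalences S) ∧
      ∃ hμ : SendsEquivalences S (comparisonUnder S).right,
        IsHomotopicallyInitial (App.weakEquivalences S) ⟨comparisonUnder S, hμ⟩ :=
  ⟨isHomotopical_app, sendsEquivalences_comparisonUnder, _, diagonalApp hS,
    fun _ _ _ _ => isHomotopical_app.id_mem _, isHomotopicalFunctor_diagonalApp hS,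
    comparisonToDiagonalApp hS, .refl _,
    .symm _ _ (.rel _ _ ⟨toDiagonalApp hS, weakEquivalences_toDiagonalApp_app hS⟩),
    weakEquivalences_comparisonToDiagonalApp_app hS⟩
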